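/- Let $S^3_1=\{x\in\mathbf R^4 : -x_0^2+x_1^2+x_2^2+x_3^2=1\}$ be de Sitter 3-space with the metric induced by $-dx_0^2+dx_1^2+dx_2^2+dx_3^2$. Let $\mathcal C=\{x_1^2+x_2^2=x_3^2\}\subset\mathbf R^3$ be the standard double cone. A real analytic 2-dimensional *DC-manifold* is a locally compact, second countable Hausdorff space $X$ with an atlas of charts onto connected open subsets of $\mathcal C$ whose transition maps are restrictions of real analytic maps between open subsets of $\mathbf R^3$; its *DC-points* are the points sent to $\mathbf 0$ by some local DC-coordinate system (a chart into $\mathcal C$ compatible with the atlas). A real analytic map $f:X\to S^3_1$ is a *real analytic DC-immersion* if around every $p\in X$ there are a local DC-coordinate system $\psi$ of $X$ and a real analytic coordinate system $\Phi$ of $S^3_1$ near $f(p)$ with $\Phi\circ f\circ\psi^{-1}(a)=a$. It is a *real analytic space-like CMC-1 DC-immersion* if moreover $X$ is connected and $f$ is a space-like immersion of constant mean curvature one (with respect to a suitable local unit normal) on an open dense subset of the set of non-DC-points. A real analytic map $f_1:\mathbf R^2\to S^3_1$ is *extended* by $f_2:X\to S^3_1$ if $f_1=f_2\circ\phi$ for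 some DC-analytic (real analytic in the DC-coordinates of $X$) map $\phi:\mathbf R^2\to X$ and $f_1(\mathbf R^2)\subsetneq f_2(X)$. A subset of $S^3_1$ is *globally analytic* if it is the zero set of a real analytic map $S^3_1\to\mathbf R^l$ for some $l\ge1$. A non-empty subset $S\subset S^3_1$ is *analytically complete* if every real analytic $\Gamma:[0,1]\to S^3_1$ with $\Gamma([0,\varepsilon))\subset S$ for some $\varepsilon\in(0,1)$ satisfies $\Gamma([0,1])\subset S$. Put $y(v)=\cosh 2v-v\sinh 2v$ and let $f_{\mathrm{LE}}:\mathbf R^2\to S^3_1$, $f_{\mathrm{LE}}(u,v)=P(u)\Gamma_{\mathrm{LE}}(v)$, be the G-catenoid of type LE, where $$P(u)=\begin{pmatrix}1+\frac{u^2}2&u&0&-\frac{u^2}2\\u&1&0&-u\\0&0&1&0\\\frac{u^2}2&u&0&1-\frac{u^2}2\end{pmatrix},\qquad \Gamma_{\mathrm{LE}}(v)=\begin{pmatrix}v\cosh2v-\frac12(v^2+2)\sinh2v\\0\\y(v)\\v\cosh2v-\frac12v^2\sinh2v\end{pmatrix}.$$ Let $\mathcal L=\{(t,0,1,t):t\in\mathbf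 R\}\subset S^3_1$, let $$\mathcal X_{\mathrm{LE}}=\{(\xi,x,v)\in\mathbf R^3:\ \xi\sinh2v+x^2+y(v)^2=1\},$$ and let $\tilde f_{\mathrm{LE}}:\mathcal X_{\mathrm{LE}}\to S^3_1$, $\tilde f_{\mathrm{LE}}(\xi,x,v)=\left(\frac{\xi-\sinh2v}2,\,x,\,y(v),\,\frac{\xi+\sinh2v}2\right)$. Equip $\mathcal X_{\mathrm{LE}}$ with the charts that are restrictions of real analytic diffeomorphisms $\Psi$ between open subsets of $\mathbf R^3$ carrying $\mathcal X_{\mathrm{LE}}\cap\operatorname{dom}\Psi$ onto a connected set $\mathcal C\cap\operatorname{ran}\Psi$. **Proposition.** 1. With these charts $\mathcal X_{\mathrm{LE}}$ is a real analytic 2-dimensional DC-manifold whose only DC-point is the origin. 2. $\tilde f_{\mathrm{LE}}$ is a real analytic space-like CMC-1 DC-immersion. More precisely, the non-DC-points near which it is a space-like CMC-1 immersion are exactly the points of $\mathcal X_{\mathrm{LE}}$ with $v\neq0$. 3. $\tilde f_{\mathrm{LE}}$ is an analytic extension of $f_{\mathrm{LE}}$, and $\tilde f_{\mathrm{LE}}(\mathcal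 X_{\mathrm{LE}})=f_{\mathrm{LE}}(\mathbf R^2)\cup\mathcal L$. 4. The function $g(s)=\sqrt{1+s^2}-\frac12 s\sinh^{-1}s$ is real analytic on $\mathbf R$ and $\tilde f_{\mathrm{LE}}(\mathcal X_{\mathrm{LE}})=S^3_1\cap\{x_2=g(x_0-x_3)\}$. 5. The image $\tilde f_{\mathrm{LE}}(\mathcal X_{\mathrm{LE}})$ is a globally analytic, and hence analytically complete, subset of $S^3_1$. -/

import Mathlib

open Set Filter Topology

noncomputable section

namespace DCGeometry

/-! ### Real analytic double-cone manifolds -/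

/-- The `m`-dimensional standard double cone
`{x ∈ ℝ^{m+1} : x₁² + ⋯ + x_m² = x_{m+1}²}`; its double-cone point is the origin. -/
def doubleCone (m : ℕ) : Set (Fin (m + 1) → ℝ) :=
  {x | ∑ j : Fin m, x j.castSucc ^ 2 = x (Fin.last m) ^ 2}

/-- A map `μ : U → ℝ^k` on a subset `U` of the double cone is real analytic if it is the
restriction of a real analytic map on an open `Ω ⊆ ℝ^{m+1}` whose trace on the cone is `U`
(in particular `U` is open in the cone). Only the values of `μ` on `U` matter. -/
def IsRealAnalyticOnCone {m k : ℕ} (U : Set (doubleCone m))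
    (μ : doubleCone m → Fin k → ℝ) : Prop :=
  ∃ Ω : Set (Fin (m + 1) → ℝ), IsOpen Ω ∧ Subtype.val ⁻¹' Ω = U ∧
    ∃ G : (Fin (m + 1) → ℝ) → Fin k → ℝ, AnalyticOnNhd ℝ G Ω ∧ ∀ a ∈ U, μ a = G a

section DCStructure

variable {m : ℕ} {X : Type*} [TopologicalSpace X]

/-- `ψ' ∘ ψ⁻¹` is real analytic where it is defined. -/
def IsAnalyticTransition (ψ ψ' : OpenPartialHomeomorph X (doubleCone m)) : Prop :=
  IsRealAnalyticOnCone (ψ.symm.trans ψ').source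
    (fun a => (ψ' (ψ.symm a) : Fin (m + 1) → ℝ))

/-- `𝒜` is a DC-structure on `X` (of dimension `m`). -/
structure IsDCStructure (𝒜 : Set (OpenPartialHomeomorph X (doubleCone m))) : Prop where
  cover : ∀ p : X, ∃ φ ∈ 𝒜, p ∈ φ.source
  connected : ∀ φ ∈ 𝒜, IsConnected φ.target
  transition : ∀ φ ∈ 𝒜, ∀ φ' ∈ 𝒜, IsAnalyticTransition φ φ'

/-- `X` with the family of charts `𝒜` is a real analytic `m`-dimensional DC-manifold. -/
structure IsDCManifold (𝒜 : Set (OpenPartialHomeomorph X (doubleCone m))) : Prop where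
  t2 : T2Space X
  locallyCompact : LocallyCompactSpace X
  secondCountable : SecondCountableTopology X
  isDCStructure : IsDCStructure 𝒜

/-- `ψ` is a local DC-coordinate system of `(X, 𝒜)`. -/
def IsDCCoordinate (𝒜 : Set (OpenPartialHomeomorph X (doubleCone m)))
    (ψ : OpenPartialHomeomorph X (doubleCone m)) : Prop :=
  ∀ φ ∈ 𝒜, IsAnalyticTransition ψ φ ∧ IsAnalyticTransition φ ψ

/-- The set of DC-points of `(X, 𝒜)`. -/
def dcPoints (𝒜 : Set (OpenPartialHomeomorph X (doubleCone m))) : Set X :=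
  {p | ∃ ψ : OpenPartialHomeomorph X (doubleCone m), IsDCCoordinate 𝒜 ψ ∧
    p ∈ ψ.source ∧ (ψ p : Fin (m + 1) → ℝ) = 0}

/-- `χ` is a local coordinate system `(u₁, …, u_m)` of the ordinary real analytic manifold
`X ∖ Σ`, where `Σ` is the set of DC-points. -/
structure IsRegularCoordinate (𝒜 : Set (OpenPartialHomeomorph X (doubleCone m)))
    (χ : OpenPartialHomeomorph X (Fin m → ℝ)) : Prop where
  source_subset : χ.source ⊆ (dcPoints 𝒜)ᶜ
  analytic_symm : ∀ φ ∈ 𝒜,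
    AnalyticOnNhd ℝ (fun w => (φ (χ.symm w) : Fin (m + 1) → ℝ)) (χ.symm.trans φ).source
  analytic : ∀ φ ∈ 𝒜,
    IsRealAnalyticOnCone (φ.symm.trans χ).source (fun a => χ (φ.symm a))

end DCStructure

/-- The charts induced on a subset `S ⊆ ℝ^{m+1}` by the ambient space: restrictions to `S` of
real analytic diffeomorphisms `Φ` between open subsets of `ℝ^{m+1}` which carry
`S ∩ dom Φ` onto the trace of the double cone on the range of `Φ`. -/
def inducedCharts {m : ℕ} (S : Set (Fin (m + 1) → ℝ)) :
    Set (OpenPartialHomeomorph S (doubleCone m)) :=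
  {φ | IsConnected φ.target ∧
    ∃ Φ : OpenPartialHomeomorph (Fin (m + 1) → ℝ) (Fin (m + 1) → ℝ),
      AnalyticOnNhd ℝ Φ Φ.source ∧ AnalyticOnNhd ℝ Φ.symm Φ.target ∧
      φ.source = Subtype.val ⁻¹' Φ.source ∧ φ.target = Subtype.val ⁻¹' Φ.target ∧
      ∀ p ∈ φ.source, (φ p : Fin (m + 1) → ℝ) = Φ p}

/-! ### Maps into an embedded real analytic submanifold `N` of `ℝ^k` -/

section Maps

variable {k : ℕ} {N : Set (Fin k → ℝ)}

/-- Real analyticity at `p` of a map defined (near `p`) on the submanifold `N ⊆ ℝ^k`: near `p`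
it is the restriction of a real analytic map of the ambient space. -/
def IsAnalyticAtOnSubmanifold {l : ℕ} (F : N → Fin l → ℝ) (p : N) : Prop :=
  ∃ G : (Fin k → ℝ) → Fin l → ℝ, AnalyticAt ℝ G p ∧ ∀ᶠ q : N in 𝓝 p, F q = G q

/-- `Φ` is a real analytic diffeomorphism from an open subset of `N` onto an open subset
of `ℝ^n`, i.e. a real analytic coordinate system of `N`. -/
structure IsAnalyticDiffeo {n : ℕ} (Φ : OpenPartialHomeomorph N (Fin n → ℝ)) : Prop where
  analytic : ∀ p ∈ Φ.source, IsAnalyticAtOnSubmanifold Φ p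
  analytic_symm : AnalyticOnNhd ℝ (fun a => (Φ.symm a : Fin k → ℝ)) Φ.target

/-- A subset of `N` is globally analytic if it is the zero set of a real analytic map
`N → ℝ^l` for some `l ≥ 1`. -/
def IsGloballyAnalytic (S : Set N) : Prop :=
  ∃ l : ℕ, 0 < l ∧ ∃ F : N → Fin l → ℝ,
    (∀ p, IsAnalyticAtOnSubmanifold F p) ∧ {p | F p = 0} = S

/-- A non-empty subset `S` of `N` is analytically complete if every real analytic curve
`Γ : [0,1] → N` with `Γ([0,ε)) ⊆ S` for some `ε ∈ (0,1)` satisfies `Γ([0,1]) ⊆ S`. -/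
def IsAnalyticallyComplete (S : Set N) : Prop :=
  S.Nonempty ∧
  ∀ Γ : ℝ → Fin k → ℝ, AnalyticOnNhd ℝ Γ (Icc 0 1) → (∀ t ∈ Icc (0 : ℝ) 1, Γ t ∈ N) →
    ∀ ε ∈ Ioo (0 : ℝ) 1, (∀ t ∈ Ico (0 : ℝ) ε, Γ t ∈ Subtype.val '' S) →
      ∀ t ∈ Icc (0 : ℝ) 1, Γ t ∈ Subtype.val '' S

variable {m : ℕ} {X : Type*} [TopologicalSpace X]

/-- `f : X → N` is DC-analytic. -/
def IsDCAnalytic (𝒜 : Set (OpenPartialHomeomorph X (doubleCone m))) (f : X → N) : Prop :=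
  ∀ φ ∈ 𝒜, IsRealAnalyticOnCone φ.target (fun a => (f (φ.symm a) : Fin k → ℝ))

/-- `p` is a DC-regular point of `f : X → N`, where `dim X = m` and `dim N = m + 1 + d`:
in suitable coordinates `f` is `a ↦ (a, 0)`, `a ∈ C ⊆ ℝ^{m+1}`, with `C` the double cone. -/
def IsDCRegularAt (d : ℕ) (𝒜 : Set (OpenPartialHomeomorph X (doubleCone m)))
    (f : X → N) (p : X) : Prop :=
  ∃ ψ : OpenPartialHomeomorph X (doubleCone m), IsDCCoordinate 𝒜 ψ ∧ p ∈ ψ.source ∧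
    ∃ Φ : OpenPartialHomeomorph N (Fin (m + 1 + d) → ℝ), IsAnalyticDiffeo Φ ∧
      ∀ q ∈ ψ.source, f q ∈ Φ.source ∧
        Φ (f q) = Fin.append (ψ q : Fin (m + 1) → ℝ) (0 : Fin d → ℝ)

/-- `f : X → N` (with `dim N = m + 1 + d`) is a real analytic DC-immersion. -/
structure IsDCImmersion (d : ℕ) (𝒜 : Set (OpenPartialHomeomorph X (doubleCone m)))
    (f : X → N) : Prop where
  analytic : IsDCAnalytic 𝒜 f
  regular : ∀ p, IsDCRegularAt d 𝒜 f p

/-- `f₂ : X → N` is an analytic extension of the map `f₁ : ℝ^m → N`: `f₁` factors as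
`f₂ ∘ ϕ` with `ϕ : ℝ^m → X` DC-analytic (`ℝ^m` being a DC-manifold without DC-points), and
the image of `f₁` is a proper subset of the image of `f₂`. -/
def IsAnalyticExtension (𝒜 : Set (OpenPartialHomeomorph X (doubleCone m)))
    (f₁ : (Fin m → ℝ) → N) (f₂ : X → N) : Prop :=
  (∃ ϕ : (Fin m → ℝ) → X, Continuous ϕ ∧
    (∀ ψ ∈ 𝒜, AnalyticOnNhd ℝ (fun w => (ψ (ϕ w) : Fin (m + 1) → ℝ)) (ϕ ⁻¹' ψ.source)) ∧
    f₁ = f₂ ∘ ϕ) ∧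
  range f₁ ⊂ range f₂

end Maps

/-! ### Space-like CMC-1 surfaces in de Sitter 3-space -/

/-- The inner product of signature `(-,+,+,+)` on `ℝ⁴`. -/
def lorentz (x y : Fin 4 → ℝ) : ℝ := -(x 0 * y 0) + x 1 * y 1 + x 2 * y 2 + x 3 * y 3

/-- De Sitter 3-space `S³₁`. -/
def deSitter : Set (Fin 4 → ℝ) := {x | lorentz x x = 1}

/-- Partial derivative in the `i`-th coordinate direction. -/
def partialDeriv (i : Fin 2) (g : (Fin 2 → ℝ) → Fin 4 → ℝ) (w : Fin 2 → ℝ) : Fin 4 → ℝ :=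
  fderiv ℝ g w (Pi.single i 1)

/-- The matrix of the first fundamental form (induced metric). -/
def firstForm (g : (Fin 2 → ℝ) → Fin 4 → ℝ) (w : Fin 2 → ℝ) : Matrix (Fin 2) (Fin 2) ℝ :=
  Matrix.of fun i j => lorentz (partialDeriv i g w) (partialDeriv j g w)

/-- The matrix of the second fundamental form with respect to `ν`. -/
def secondForm (g ν : (Fin 2 → ℝ) → Fin 4 → ℝ) (w : Fin 2 → ℝ) : Matrix (Fin 2) (Fin 2) ℝ :=
  Matrix.of fun i j => lorentz (partialDeriv i (partialDeriv j g) w) (ν w)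

/-- The mean curvature with respect to `ν`: half the trace of the shape operator. -/
def meanCurvature (g ν : (Fin 2 → ℝ) → Fin 4 → ℝ) (w : Fin 2 → ℝ) : ℝ :=
  ((firstForm g w)⁻¹ * secondForm g ν w).trace / 2

/-- `ν` is, at `w`, a unit (time-like) normal vector of the space-like surface `g` in `S³₁`. -/
structure IsUnitNormalAt (g ν : (Fin 2 → ℝ) → Fin 4 → ℝ) (w : Fin 2 → ℝ) : Prop where
  unit : lorentz (ν w) (ν w) = -1
  tangent_deSitter : lorentz (ν w) (g w) = 0
  normal : ∀ i, lorentz (ν w) (partialDeriv i g w) = 0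

/-- `g : D → S³₁` (`D` an open subset of the plane) is a real analytic space-like immersion of
constant mean curvature one, with respect to a suitable unit normal field. -/
structure IsSpacelikeCMC1 (D : Set (Fin 2 → ℝ)) (g : (Fin 2 → ℝ) → Fin 4 → ℝ) : Prop where
  analytic : AnalyticOnNhd ℝ g D
  mem_deSitter : ∀ w ∈ D, g w ∈ deSitter
  spacelike : ∀ w ∈ D, (firstForm g w).PosDef
  cmc1 : ∃ ν : (Fin 2 → ℝ) → Fin 4 → ℝ, ContinuousOn ν D ∧
    ∀ w ∈ D, IsUnitNormalAt g ν w ∧ meanCurvature g ν w = 1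

section CMC

variable {X : Type*} [TopologicalSpace X]

/-- Near `p` (a non-DC-point), `f : X → S³₁` is a space-like CMC-1 immersion. -/
def IsSpacelikeCMC1Near (𝒜 : Set (OpenPartialHomeomorph X (doubleCone 2)))
    (f : X → deSitter) (p : X) : Prop :=
  ∃ χ : OpenPartialHomeomorph X (Fin 2 → ℝ), IsRegularCoordinate 𝒜 χ ∧ p ∈ χ.source ∧
    IsSpacelikeCMC1 χ.target (fun w => (f (χ.symm w) : Fin 4 → ℝ))

/-- `f : X → S³₁` is a real analytic space-like CMC-1 DC-immersion: `X` is a connected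
2-dimensional DC-manifold, `f` is a real analytic DC-immersion, and on an open dense set of
non-DC-points `f` is a space-like CMC-1 immersion. (By continuity, the remaining non-DC-points
are light-like, i.e. points where the induced metric degenerates, or are also space-like of
mean curvature one.) -/
structure IsSpacelikeCMC1DCImmersion (𝒜 : Set (OpenPartialHomeomorph X (doubleCone 2)))
    (f : X → deSitter) : Prop where
  connected : ConnectedSpace X
  isDCManifold : IsDCManifold 𝒜
  isDCImmersion : IsDCImmersion 0 𝒜 f
  cmc1 : ∃ W : Set X, IsOpen W ∧ Dense W ∧ W ⊆ (dcPoints 𝒜)ᶜ ∧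
    ∀ p ∈ W, IsSpacelikeCMC1Near 𝒜 f p

end CMC

/-! ### The G-catenoid of type LE and its extension -/

/-- The one-parameter group of isometries. -/
def rotL (u : ℝ) : Matrix (Fin 4) (Fin 4) ℝ :=
  !![1 + u ^ 2 / 2, u, 0, -(u ^ 2 / 2);
     u, 1, 0, -u;
     0, 0, 1, 0;
     u ^ 2 / 2, u, 0, 1 - u ^ 2 / 2]

/-- `y_LE(v) = cosh 2v - v sinh 2v`. -/
def yLE (v : ℝ) : ℝ := Real.cosh (2 * v) - v * Real.sinh (2 * v)

/-- The profile curve `Γ_LE`. -/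
def profileLE (v : ℝ) : Fin 4 → ℝ :=
  ![v * Real.cosh (2 * v) - 1 / 2 * (v ^ 2 + 2) * Real.sinh (2 * v),
    0,
    yLE v,
    v * Real.cosh (2 * v) - 1 / 2 * v ^ 2 * Real.sinh (2 * v)]

theorem rotL_profileLE_mem (u v : ℝ) : (rotL u).mulVec (profileLE v) ∈ deSitter := by
  have h := Real.cosh_sq (2 * v)
  simp only [deSitter, lorentz, rotL, profileLE, yLE, Matrix.mulVec, dotProduct,
    Fin.sum_univ_four, mem_ofPred_eq]
  simp
  linear_combination h

/-- The G-catenoid of type LE, `f_LE(u,v) = P(u) Γ_LE(v)`, with `w = (u, v)`. -/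
def catenoidLE (w : Fin 2 → ℝ) : deSitter :=
  ⟨(rotL (w 0)).mulVec (profileLE (w 1)), rotL_profileLE_mem _ _⟩

/-- `X_LE = {(ξ,x,v) : ξ sinh 2v + x² + y_LE(v)² = 1}`. -/
def XLE : Set (Fin 3 → ℝ) :=
  {p | p 0 * Real.sinh (2 * p 2) + p 1 ^ 2 + yLE (p 2) ^ 2 = 1}

theorem extLE_mem (p : XLE) :
    (![(p.1 0 - Real.sinh (2 * p.1 2)) / 2, p.1 1, yLE (p.1 2),
      (p.1 0 + Real.sinh (2 * p.1 2)) / 2] : Fin 4 → ℝ) ∈ deSitter := by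
  have h : p.1 0 * Real.sinh (2 * p.1 2) + p.1 1 ^ 2 + yLE (p.1 2) ^ 2 = 1 := p.2
  simp only [deSitter, lorentz, mem_ofPred_eq]
  simp
  linear_combination h

/-- The map `(ξ,x,v) ↦ ((ξ - sinh 2v)/2, x, y_LE(v), (ξ + sinh 2v)/2)` from `X_LE` to `S³₁`. -/
def extLE (p : XLE) : deSitter :=
  ⟨![(p.1 0 - Real.sinh (2 * p.1 2)) / 2, p.1 1, yLE (p.1 2),
    (p.1 0 + Real.sinh (2 * p.1 2)) / 2], extLE_mem p⟩

/-- The light-like line `{(t,0,1,t) : t ∈ ℝ}`. -/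
def lightLine : Set deSitter := {q | ∃ t : ℝ, (q : Fin 4 → ℝ) = ![t, 0, 1, t]}

/-- `s ↦ √(1+s²) - (s/2) sinh⁻¹ s`. -/
def graphFun (s : ℝ) : ℝ := Real.sqrt (1 + s ^ 2) - 1 / 2 * s * Real.arsinh s

end DCGeometry

end

/-! Everything rests on the identity y² − 1 = sinh 2v · k(v) with k analytic (`yLE_sq`). It turns
the equation of `XLE` into ab + x² = 0 with a = sinh 2v and b = ξ + k(v), a linear form of the
double cone. Since v ↦ sinh 2v is an analytic diffeomorphism of ℝ, `straighten` is an analytic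
diffeomorphism of ℝ³ carrying `XLE` onto the cone, and one global chart suffices. Only its vertex is
a DC-point, because an analytic change of coordinates of the cone fixes the vertex
(`vertex_eq_zero`).

For the immersion, `straighten` is matched with coordinates of de Sitter space on two open sets, x₂
> 0 and x₃ ≠ x₀ (`isDCRegularAt_extLE_of_pos`, `isDCRegularAt_extLE_of_ne`). Their preimages cover
`XLE`, since y(0) = 1.

Where v ≠ 0 the surface is the G-catenoid itself: (u, v) are isothermal with factor sinh² 2v, and an
explicit normal gives mean curvature one (`firstForm_catVec`, `meanCurvature_catVec`). Where v = 0
the induced metric has rank at most one (`ne_zero_of_isSpacelikeCMC1Near`).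

Finally x₃ − x₀ = sinh 2v determines v, and y(v) = g(sinh 2v), so the image is the graph x₂ = g(x₀ −
x₃) (`range_extLE_eq_graph`). It is the zero set of one analytic function, and the identity theorem
along curves gives completeness. -/

noncomputable section

namespace DCGeometry

/-! ### Real analyticity of explicit maps -/

attribute [fun_prop] Real.analyticAt_sinh Real.analyticAt_cosh Real.analyticAt_arsinh
  analyticAt_fst analyticAt_snd

section Analytic

variable {E : Type*} [NormedAddCommGroup E] [NormedSpace ℝ E] {x : E}

@[fun_prop]
theorem analyticAt_apply {n : ℕ} (i : Fin n) (p : Fin n → ℝ) :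
    AnalyticAt ℝ (fun q : Fin n → ℝ => q i) p :=
  (ContinuousLinearMap.proj (R := ℝ) (φ := fun _ : Fin n => ℝ) i).analyticAt p

theorem analyticAt_vec2 {f g : E → ℝ} (hf : AnalyticAt ℝ f x) (hg : AnalyticAt ℝ g x) :
    AnalyticAt ℝ (fun y => ![f y, g y]) x := by
  rw [analyticAt_pi_iff]
  intro i
  fin_cases i <;> assumption

theorem analyticAt_vec3 {f g h : E → ℝ} (hf : AnalyticAt ℝ f x) (hg : AnalyticAt ℝ g x)
    (hh : AnalyticAt ℝ h x) : AnalyticAt ℝ (fun y => ![f y, g y, h y]) x := by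
  rw [analyticAt_pi_iff]
  intro i
  fin_cases i <;> assumption

theorem analyticAt_vec4 {f g h k : E → ℝ} (hf : AnalyticAt ℝ f x) (hg : AnalyticAt ℝ g x)
    (hh : AnalyticAt ℝ h x) (hk : AnalyticAt ℝ k x) :
    AnalyticAt ℝ (fun y => ![f y, g y, h y, k y]) x := by
  rw [analyticAt_pi_iff]
  intro i
  fin_cases i <;> assumption

theorem analyticAt_sqrt_comp {f : E → ℝ} (hf : AnalyticAt ℝ f x) (h : 0 < f x) :
    AnalyticAt ℝ (fun y => √(f y)) x :=
  (hf.contDiffAt.sqrt h.ne').analyticAt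

end Analytic

/-! ### Charts induced by ambient diffeomorphisms -/

section Ambient

variable {m k : ℕ} {S : Set (Fin (m + 1) → ℝ)}

/-- `φ` is the restriction to `S` of the real analytic diffeomorphism `Φ`. -/
structure IsAmbientRestriction (φ : OpenPartialHomeomorph S (doubleCone m))
    (Φ : OpenPartialHomeomorph (Fin (m + 1) → ℝ) (Fin (m + 1) → ℝ)) : Prop where
  analytic : AnalyticOnNhd ℝ Φ Φ.source
  analytic_symm : AnalyticOnNhd ℝ Φ.symm Φ.target
  source_eq : φ.source = Subtype.val ⁻¹' Φ.source
  target_eq : φ.target = Subtype.val ⁻¹' Φ.target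
  apply_eq : ∀ p ∈ φ.source, (φ p : Fin (m + 1) → ℝ) = Φ p

namespace IsAmbientRestriction

variable {φ φ' : OpenPartialHomeomorph S (doubleCone m)}
  {Φ Φ' : OpenPartialHomeomorph (Fin (m + 1) → ℝ) (Fin (m + 1) → ℝ)}

theorem symm_apply_eq (h : IsAmbientRestriction φ Φ) {a : doubleCone m} (ha : a ∈ φ.target) :
    (φ.symm a : Fin (m + 1) → ℝ) = Φ.symm a := by
  have hs : φ.symm a ∈ φ.source := φ.map_target ha
  have h1 := h.apply_eq _ hs
  rw [φ.right_inv ha] at h1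
  rw [h1, Φ.left_inv]
  have := h.source_eq ▸ hs
  exact this

/-- `G ∘ Φ.symm` is the ambient analytic extension. Transitions, DC-analyticity and regular
coordinates are all checked through this one fact. -/
theorem isRealAnalyticOnCone_comp_symm (h : IsAmbientRestriction φ Φ)
    {O : Set (Fin (m + 1) → ℝ)} (hO : IsOpen O) {G : (Fin (m + 1) → ℝ) → Fin k → ℝ}
    (hG : AnalyticOnNhd ℝ G O) {U : Set (doubleCone m)}
    (hU : U = φ.target ∩ φ.symm ⁻¹' (Subtype.val ⁻¹' O)) {μ : doubleCone m → Fin k → ℝ}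
    (hμ : ∀ a ∈ U, μ a = G (φ.symm a)) : IsRealAnalyticOnCone U μ := by
  refine ⟨Φ.target ∩ Φ.symm ⁻¹' O, Φ.isOpen_inter_preimage_symm hO, ?_, G ∘ Φ.symm, ?_, ?_⟩
  · ext a
    rw [hU]
    have ht : a ∈ φ.target ↔ (a : Fin (m + 1) → ℝ) ∈ Φ.target := by rw [h.target_eq]; rfl
    constructor
    · rintro ⟨h1, h2⟩
      refine ⟨ht.2 h1, ?_⟩
      simp only [mem_preimage] at h2 ⊢
      rwa [h.symm_apply_eq (ht.2 h1)]
    · rintro ⟨h1, h2⟩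
      refine ⟨ht.1 h1, ?_⟩
      simp only [mem_preimage] at h2 ⊢
      rwa [← h.symm_apply_eq h1]
  · exact hG.comp (h.analytic_symm.mono inter_subset_left) fun a ha => ha.2
  · intro a ha
    rw [hμ a ha, h.symm_apply_eq (hU ▸ ha).1]
    rfl

theorem isAnalyticTransition (h : IsAmbientRestriction φ Φ) (h' : IsAmbientRestriction φ' Φ') :
    IsAnalyticTransition φ φ' := by
  refine h.isRealAnalyticOnCone_comp_symm Φ'.open_source h'.analytic ?_ fun a ha => ?_
  · rw [OpenPartialHomeomorph.trans_source, ← h'.source_eq]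
    rfl
  · rw [OpenPartialHomeomorph.trans_source] at ha
    exact h'.apply_eq _ ha.2

theorem isDCCoordinate (h : IsAmbientRestriction φ Φ) : IsDCCoordinate (inducedCharts S) φ := by
  rintro ψ ⟨-, Ψ, h1, h2, h3, h4, h5⟩
  exact ⟨h.isAnalyticTransition ⟨h1, h2, h3, h4, h5⟩,
    IsAmbientRestriction.isAnalyticTransition ⟨h1, h2, h3, h4, h5⟩ h⟩

/-- Shrinking may disconnect the target, so the result need not lie in `inducedCharts S`. It is
still a DC-coordinate system, since `isDCCoordinate` uses only the ambient diffeomorphism. -/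
theorem restrOpen (h : IsAmbientRestriction φ Φ) {O : Set (Fin (m + 1) → ℝ)} (hO : IsOpen O) :
    IsAmbientRestriction (φ.restrOpen (Subtype.val ⁻¹' O) (hO.preimage continuous_subtype_val))
      (Φ.restrOpen O hO) where
  analytic := h.analytic.mono inter_subset_left
  analytic_symm := h.analytic_symm.mono inter_subset_left
  source_eq := by
    change φ.source ∩ _ = _ ⁻¹' (Φ.source ∩ _)
    rw [h.source_eq, preimage_inter]
  target_eq := by
    change φ.target ∩ φ.symm ⁻¹' (Subtype.val ⁻¹' O) = _ ⁻¹' (Φ.target ∩ Φ.symm ⁻¹' O)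
    rw [preimage_inter, ← h.target_eq]
    ext a
    refine and_congr_right fun ha => ?_
    simp only [mem_preimage, h.symm_apply_eq ha]
  apply_eq p hp := h.apply_eq p hp.1

end IsAmbientRestriction

theorem exists_isAmbientRestriction {φ : OpenPartialHomeomorph S (doubleCone m)}
    (h : φ ∈ inducedCharts S) : ∃ Φ, IsAmbientRestriction φ Φ := by
  obtain ⟨-, Φ, h1, h2, h3, h4, h5⟩ := h
  exact ⟨Φ, h1, h2, h3, h4, h5⟩

theorem isDCStructure_inducedCharts (hS : ∀ p : S, ∃ φ ∈ inducedCharts S, p ∈ φ.source) :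
    IsDCStructure (inducedCharts S) where
  cover := hS
  connected _ h := h.1
  transition φ h φ' h' := by
    obtain ⟨Φ, hΦ⟩ := exists_isAmbientRestriction h
    obtain ⟨Φ', hΦ'⟩ := exists_isAmbientRestriction h'
    exact hΦ.isAnalyticTransition hΦ'

/-- The restriction to `S` of a real analytic map on `ℝ^{m+1}` is DC-analytic. -/
theorem isDCAnalytic_of_ambient {N : Set (Fin k → ℝ)} {f : S → N}
    {G : (Fin (m + 1) → ℝ) → Fin k → ℝ} (hG : AnalyticOnNhd ℝ G univ)
    (hf : ∀ p, (f p : Fin k → ℝ) = G p) : IsDCAnalytic (inducedCharts S) f := by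
  intro φ h
  obtain ⟨Φ, hΦ⟩ := exists_isAmbientRestriction h
  exact hΦ.isRealAnalyticOnCone_comp_symm isOpen_univ hG (by simp) fun a _ => hf _

end Ambient

/-! ### Double-cone points are distinguished -/

theorem mem_doubleCone_two {a : Fin 3 → ℝ} :
    a ∈ doubleCone 2 ↔ a 0 ^ 2 + a 1 ^ 2 = a 2 ^ 2 := by
  simp [doubleCone, Fin.sum_univ_two]

/-- The cone contains a basis of ℝ³. -/
theorem eq_zero_of_doubleCone {M : Type*} [AddCommGroup M] [Module ℝ M]
    {L : (Fin 3 → ℝ) →ₗ[ℝ] M} (hL : ∀ v ∈ doubleCone 2, L v = 0) : L = 0 := by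
  have h1 := hL ![1, 0, 1] (mem_doubleCone_two.2 (by simp))
  have h2 := hL ![1, 0, -1] (mem_doubleCone_two.2 (by simp))
  have h3 := hL ![0, 1, 1] (mem_doubleCone_two.2 (by simp))
  refine LinearMap.ext fun v => ?_
  have hv : v = ((v 0 + v 2 - v 1) / 2) • ![1, 0, 1] + ((v 0 - v 2 + v 1) / 2) • ![1, 0, -1] +
      v 1 • ![0, 1, 1] := by
    ext i
    fin_cases i <;> simp <;> ring
  rw [hv, map_add, map_add, map_smul, map_smul, map_smul, h1, h2, h3]
  simp

/-- A real analytic map defined near the vertex of the double cone, mapping the cone to itself and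
admitting a local real analytic inverse along the cone, fixes the vertex. -/
theorem vertex_eq_zero {G H : (Fin 3 → ℝ) → Fin 3 → ℝ}
    (hG : DifferentiableAt ℝ G 0) (hH : DifferentiableAt ℝ H (G 0))
    (hGC : ∀ᶠ a in 𝓝 (0 : Fin 3 → ℝ), a ∈ doubleCone 2 → G a ∈ doubleCone 2 ∧ H (G a) = a) :
    G 0 = 0 := by
  set c := G 0 with hc
  set G' := fderiv ℝ G 0 with hG'
  set H' := fderiv ℝ H c with hH'
  -- The cone is a union of lines through 0. Differentiating the cone equation of `G (t • v)` and
  -- the identity `H (G (t • v)) = t • v` at `t = 0` gives the two relations.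
  have key : ∀ v ∈ doubleCone 2,
      c 0 * G' v 0 + c 1 * G' v 1 - c 2 * G' v 2 = 0 ∧ H' (G' v) = v := by
    intro v hv
    have hcurve : HasDerivAt (fun t : ℝ => t • v) v 0 := by
      simpa using (hasDerivAt_id (0 : ℝ)).smul_const v
    have ht : Tendsto (fun t : ℝ => t • v) (𝓝 0) (𝓝 0) := by
      simpa using hcurve.continuousAt.tendsto
    have hev := ht.eventually hGC
    have hmem : ∀ t : ℝ, t • v ∈ doubleCone 2 := by
      intro t
      rw [mem_doubleCone_two] at hv ⊢
      simp only [Pi.smul_apply, smul_eq_mul]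
      linear_combination t ^ 2 * hv
    have hGd : HasDerivAt (fun t : ℝ => G (t • v)) (G' v) 0 := by
      have : HasFDerivAt G G' ((0 : ℝ) • v) := by rw [zero_smul]; exact hG.hasFDerivAt
      exact this.comp_hasDerivAt 0 hcurve
    have hHd : HasDerivAt (fun t : ℝ => H (G (t • v))) (H' (G' v)) 0 := by
      have : HasFDerivAt H H' (G ((0 : ℝ) • v)) := by rw [zero_smul]; exact hH.hasFDerivAt
      exact this.comp_hasDerivAt 0 hGd
    refine ⟨?_, ?_⟩
    · have hi := hasDerivAt_pi.1 hGd
      have hq := (((hi 0).pow 2).add ((hi 1).pow 2)).sub ((hi 2).pow 2)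
      have h0 : HasDerivAt (fun _ : ℝ => (0 : ℝ)) 0 0 := hasDerivAt_const _ _
      have he := h0.congr_of_eventuallyEq (f₁ := (((fun t : ℝ => G (t • v) 0) ^ 2 +
        (fun t : ℝ => G (t • v) 1) ^ 2) - (fun t : ℝ => G (t • v) 2) ^ 2)) (by
          filter_upwards [hev] with t h
          have := mem_doubleCone_two.1 (h (hmem t)).1
          simp only [Pi.sub_apply, Pi.add_apply, Pi.pow_apply]
          linarith)
      have := hq.unique he
      simp only [zero_smul, ← hc] at this
      push_cast at this
      linarith
    · refine hHd.unique (hcurve.congr_of_eventuallyEq ?_)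
      filter_upwards [hev] with t h using (h (hmem t)).2
  -- `B` is the polar form of the cone's quadratic form at `c`. Both relations are linear in `v`, so
  -- they extend from the cone to all of ℝ³; in particular `G'` is bijective.
  let B : (Fin 3 → ℝ) →ₗ[ℝ] ℝ :=
    c 0 • LinearMap.proj 0 + c 1 • LinearMap.proj 1 - c 2 • LinearMap.proj 2
  have hB : ∀ w, B w = c 0 * w 0 + c 1 * w 1 - c 2 * w 2 := fun w => by simp [B]
  have hBG : B.comp G'.toLinearMap = 0 := eq_zero_of_doubleCone fun v hv => by
    simpa [hB] using (key v hv).1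
  have hHG : H'.toLinearMap.comp G'.toLinearMap - LinearMap.id = 0 :=
    eq_zero_of_doubleCone fun v hv => by simpa [sub_eq_zero] using (key v hv).2
  have hinj : Function.Injective G'.toLinearMap :=
    Function.LeftInverse.injective (g := H') fun v => by
      simpa [sub_eq_zero] using LinearMap.congr_fun hHG v
  -- On this vector `B` takes the value c₀² + c₁² + c₂², which must therefore vanish.
  obtain ⟨w, hw⟩ := LinearMap.injective_iff_surjective.1 hinj ![c 0, c 1, -c 2]
  have h0 := LinearMap.congr_fun hBG w
  rw [LinearMap.comp_apply, hw, hB] at h0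
  simp at h0
  have h1 : c 0 = 0 := by nlinarith [sq_nonneg (c 0), sq_nonneg (c 1), sq_nonneg (c 2)]
  have h2 : c 1 = 0 := by nlinarith [sq_nonneg (c 0), sq_nonneg (c 1), sq_nonneg (c 2)]
  have h3 : c 2 = 0 := by nlinarith [sq_nonneg (c 0), sq_nonneg (c 1), sq_nonneg (c 2)]
  ext i
  fin_cases i <;> assumption

/-- A DC-point is seen as the vertex by one coordinate system; applying `vertex_eq_zero` to the
transition shows that every chart sees it so. -/
theorem dcPoint_apply_eq_zero {X : Type*} [TopologicalSpace X]
    {𝒜 : Set (OpenPartialHomeomorph X (doubleCone 2))} {p : X} (hp : p ∈ dcPoints 𝒜)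
    {φ : OpenPartialHomeomorph X (doubleCone 2)} (hφ : φ ∈ 𝒜) (hpφ : p ∈ φ.source) :
    (φ p : Fin 3 → ℝ) = 0 := by
  obtain ⟨ψ, hψ, hps, hp0⟩ := hp
  obtain ⟨⟨Ω, hΩ, hΩU, G, hG, hGμ⟩, ⟨Ω', hΩ', hΩU', H, hH, hHμ⟩⟩ := hψ φ hφ
  have h0 : ψ p ∈ (ψ.symm.trans φ).source := by
    rw [OpenPartialHomeomorph.trans_source]
    exact ⟨ψ.map_source hps, by simpa [ψ.left_inv hps] using hpφ⟩
  have hm : ∀ a : doubleCone 2, a ∈ (ψ.symm.trans φ).source →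
      φ (ψ.symm a) ∈ (φ.symm.trans ψ).source := by
    intro a ha
    rw [OpenPartialHomeomorph.trans_source] at ha ⊢
    refine ⟨φ.map_source ha.2, ?_⟩
    have : φ.symm (φ (ψ.symm a)) = ψ.symm a := φ.left_inv ha.2
    rw [mem_preimage, this]
    exact ψ.map_target ha.1
  have hG0 : (φ p : Fin 3 → ℝ) = G 0 := by
    have := hGμ _ h0
    beta_reduce at this
    rwa [ψ.left_inv hps, hp0] at this
  have hz : (0 : Fin 3 → ℝ) ∈ Ω := by
    rw [← hΩU] at h0
    simpa [hp0] using h0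
  have hc : G 0 ∈ Ω' := by
    have := hm _ h0
    rw [← hΩU', ψ.left_inv hps, mem_preimage, hG0] at this
    exact this
  rw [hG0]
  refine vertex_eq_zero (H := H) (hG 0 hz).differentiableAt (hH _ hc).differentiableAt ?_
  filter_upwards [hΩ.mem_nhds hz] with a ha haC
  have has : (⟨a, haC⟩ : doubleCone 2) ∈ (ψ.symm.trans φ).source := by
    rw [← hΩU]
    exact ha
  have h1 := hGμ _ has
  have h2 := hHμ _ (hm _ has)
  rw [OpenPartialHomeomorph.trans_source] at has
  beta_reduce at h1 h2
  rw [φ.left_inv has.2, ψ.right_inv has.1, h1] at h2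
  exact ⟨h1 ▸ (φ (ψ.symm ⟨a, haC⟩)).2, h2.symm⟩

/-! ### A global straightening of `X_LE` -/

/-- The real analytic function with `y_LE(v)² - 1 = sinh 2v · k_LE(v)`. -/
def kLE (v : ℝ) : ℝ := (1 + v ^ 2) * Real.sinh (2 * v) - 2 * v * Real.cosh (2 * v)

/-- Replacing cosh² by 1 + sinh² in y² leaves 1 plus terms that all carry a factor sinh 2v. -/
theorem yLE_sq (v : ℝ) : yLE v ^ 2 = 1 + Real.sinh (2 * v) * kLE v := by
  have h := Real.cosh_sq (2 * v)
  simp only [yLE, kLE]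
  linear_combination h

@[fun_prop]
theorem analyticAt_yLE (v : ℝ) : AnalyticAt ℝ yLE v := by
  unfold yLE
  fun_prop

@[fun_prop]
theorem analyticAt_kLE (v : ℝ) : AnalyticAt ℝ kLE v := by
  unfold kLE
  fun_prop

/-- The linear coordinates in which `x² + a b` becomes the quadratic form of the double cone. -/
def coneVec (x a b : ℝ) : Fin 3 → ℝ := ![x, (a + b) / 2, (a - b) / 2]

theorem coneVec_mem {x a b : ℝ} : coneVec x a b ∈ doubleCone 2 ↔ a * b + x ^ 2 = 0 := by
  rw [mem_doubleCone_two]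
  simp only [coneVec, Matrix.cons_val]
  constructor <;> intro h <;> linear_combination h

theorem coneVec_surj (c : Fin 3 → ℝ) : coneVec (c 0) (c 1 + c 2) (c 1 - c 2) = c := by
  ext i
  fin_cases i <;> simp [coneVec]

theorem coneVec_add (x a b : ℝ) : coneVec x a b 1 + coneVec x a b 2 = a := by
  simp only [coneVec, Matrix.cons_val]
  ring

theorem coneVec_sub (x a b : ℝ) : coneVec x a b 1 - coneVec x a b 2 = b := by
  simp only [coneVec, Matrix.cons_val]
  ring

theorem analyticAt_coneVec {E : Type*} [NormedAddCommGroup E] [NormedSpace ℝ E] {p : E}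
    {x a b : E → ℝ} (hx : AnalyticAt ℝ x p) (ha : AnalyticAt ℝ a p) (hb : AnalyticAt ℝ b p) :
    AnalyticAt ℝ (fun q => coneVec (x q) (a q) (b q)) p :=
  analyticAt_vec3 hx (by fun_prop) (by fun_prop)

/-- The map `(ξ, x, v) ↦ coneVec x (sinh 2v) (ξ + k_LE(v))`. -/
def straighten (p : Fin 3 → ℝ) : Fin 3 → ℝ :=
  coneVec (p 1) (Real.sinh (2 * p 2)) (p 0 + kLE (p 2))

/-- The inverse of `straighten`. -/
def straightenSymm (c : Fin 3 → ℝ) : Fin 3 → ℝ :=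
  ![c 1 - c 2 - kLE (Real.arsinh (c 1 + c 2) / 2), c 0, Real.arsinh (c 1 + c 2) / 2]

theorem analyticOnNhd_straighten {s : Set (Fin 3 → ℝ)} : AnalyticOnNhd ℝ straighten s :=
  fun _ _ => analyticAt_coneVec (by fun_prop) (by fun_prop) (by fun_prop)

theorem analyticOnNhd_straightenSymm {s : Set (Fin 3 → ℝ)} :
    AnalyticOnNhd ℝ straightenSymm s :=
  fun _ _ => analyticAt_vec3 (by fun_prop) (by fun_prop) (by fun_prop)

theorem straightenSymm_coneVec (x a b : ℝ) : straightenSymm (coneVec x a b) =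
    ![b - kLE (Real.arsinh a / 2), x, Real.arsinh a / 2] := by
  rw [straightenSymm, coneVec_add, coneVec_sub]
  rfl

/-- `straighten` as a homeomorphism of `ℝ³`. -/
def straightenHomeomorph : (Fin 3 → ℝ) ≃ₜ (Fin 3 → ℝ) where
  toFun := straighten
  invFun := straightenSymm
  left_inv p := by
    rw [straighten, straightenSymm_coneVec, Real.arsinh_sinh]
    ext i
    fin_cases i <;> simp
  right_inv c := by
    conv_rhs => rw [← coneVec_surj c]
    simp [straighten, straightenSymm, mul_div_cancel₀]
  continuous_toFun := (analyticOnNhd_straighten (s := univ)).continuous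
  continuous_invFun := (analyticOnNhd_straightenSymm (s := univ)).continuous

theorem mem_XLE_iff (p : Fin 3 → ℝ) : p ∈ XLE ↔ straighten p ∈ doubleCone 2 := by
  rw [straighten, coneVec_mem]
  simp only [XLE, mem_ofPred_eq, yLE_sq]
  constructor <;> intro h <;> linear_combination h

/-- The global chart of `X_LE` onto the double cone. -/
def chartLE : XLE ≃ₜ doubleCone 2 := straightenHomeomorph.subtype mem_XLE_iff

theorem chartLE_apply (p : XLE) : (chartLE p : Fin 3 → ℝ) = straighten p := rfl

theorem isAmbientRestriction_chartLE :
    IsAmbientRestriction (S := XLE) chartLE.toOpenPartialHomeomorph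
      straightenHomeomorph.toOpenPartialHomeomorph where
  analytic := analyticOnNhd_straighten
  analytic_symm := analyticOnNhd_straightenSymm
  source_eq := rfl
  target_eq := rfl
  apply_eq _ _ := rfl

/-- The cone is star-shaped about its vertex. -/
theorem isPreconnected_doubleCone (m : ℕ) : IsPreconnected (doubleCone m) := by
  have h0 : (0 : Fin (m + 1) → ℝ) ∈ doubleCone m := by simp [doubleCone]
  have hs : StarConvex ℝ 0 (doubleCone m) := by
    intro x hx a b _ _ _
    simp only [doubleCone, mem_ofPred_eq, smul_zero, zero_add, Pi.smul_apply, smul_eq_mul,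
      mul_pow, ← Finset.mul_sum] at hx ⊢
    rw [hx]
  exact (hs.isPathConnected h0).isConnected.isPreconnected

instance : ConnectedSpace (doubleCone 2) where
  toPreconnectedSpace := Subtype.preconnectedSpace (isPreconnected_doubleCone 2)
  toNonempty := ⟨⟨0, by simp [doubleCone]⟩⟩

theorem chartLE_mem : chartLE.toOpenPartialHomeomorph ∈ inducedCharts XLE :=
  ⟨isConnected_univ, straightenHomeomorph.toOpenPartialHomeomorph,
    analyticOnNhd_straighten, analyticOnNhd_straightenSymm, rfl, rfl, fun _ _ => rfl⟩

theorem isDCManifold_XLE : IsDCManifold (inducedCharts XLE) where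
  t2 := inferInstance
  locallyCompact := by
    have : IsClosed (doubleCone 2) := by
      unfold doubleCone
      exact isClosed_eq (by fun_prop) (by fun_prop)
    have := this.isClosedEmbedding_subtypeVal.locallyCompactSpace
    exact chartLE.isClosedEmbedding.locallyCompactSpace
  secondCountable := inferInstance
  isDCStructure := isDCStructure_inducedCharts fun p => ⟨_, chartLE_mem, mem_univ p⟩

theorem dcPoints_XLE : dcPoints (inducedCharts XLE) = {p : XLE | (p : Fin 3 → ℝ) = 0} := by
  have hz : straighten 0 = 0 := by
    ext i
    fin_cases i <;> simp [straighten, coneVec, kLE]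
  ext p
  constructor
  · intro hp
    have h : straighten p = straighten 0 := by
      rw [hz]
      exact dcPoint_apply_eq_zero hp chartLE_mem (mem_univ p)
    exact straightenHomeomorph.injective h
  · intro hp
    refine ⟨_, isAmbientRestriction_chartLE.isDCCoordinate, mem_univ p, ?_⟩
    have : (p : Fin 3 → ℝ) = 0 := hp
    rw [Homeomorph.toOpenPartialHomeomorph_apply, chartLE_apply, this, hz]

/-! ### The extension is a DC-immersion -/

/-- Mutually inverse real analytic maps of the ambient spaces restrict to a coordinate system of
the subset `N`. -/
theorem exists_isAnalyticDiffeo {k n : ℕ} {N : Set (Fin k → ℝ)} (hN : N.Nonempty)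
    {G : (Fin k → ℝ) → Fin n → ℝ} {K : (Fin n → ℝ) → Fin k → ℝ} {U : Set (Fin k → ℝ)}
    {V : Set (Fin n → ℝ)} (hU : IsOpen U) (hV : IsOpen V) (hG : AnalyticOnNhd ℝ G U)
    (hK : AnalyticOnNhd ℝ K V) (hGV : ∀ q ∈ N, q ∈ U → G q ∈ V ∧ K (G q) = q)
    (hKU : ∀ c ∈ V, K c ∈ N ∧ K c ∈ U ∧ G (K c) = c) :
    ∃ Φ : OpenPartialHomeomorph N (Fin n → ℝ), IsAnalyticDiffeo Φ ∧
      Φ.source = Subtype.val ⁻¹' U ∧ ∀ q, Φ q = G q := by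
  classical
  -- The inverse must be total with values in `N`; the default point is never used on `V`.
  let inv : (Fin n → ℝ) → N := fun c => if h : K c ∈ N then ⟨K c, h⟩ else ⟨_, hN.some_mem⟩
  have inv_eq : ∀ c ∈ V, (inv c : Fin k → ℝ) = K c := by
    intro c hc
    simp [inv, (hKU c hc).1]
  let Φ : OpenPartialHomeomorph N (Fin n → ℝ) :=
    { toFun := fun q => G q
      invFun := inv
      source := Subtype.val ⁻¹' U
      target := V
      map_source' := fun q hq => (hGV q q.2 hq).1
      map_target' := fun c hc => by
        rw [mem_preimage, inv_eq c hc]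
        exact (hKU c hc).2.1
      left_inv' := fun q hq => Subtype.ext <| by
        rw [inv_eq _ (hGV q q.2 hq).1]
        exact (hGV q q.2 hq).2
      right_inv' := fun c hc => by
        rw [inv_eq c hc]
        exact (hKU c hc).2.2
      open_source := hU.preimage continuous_subtype_val
      open_target := hV
      continuousOn_toFun := hG.continuousOn.comp continuous_subtype_val.continuousOn fun q hq => hq
      continuousOn_invFun := by
        rw [continuousOn_iff_continuous_domRestrict, continuous_induced_rng]
        exact (continuousOn_iff_continuous_domRestrict.1 hK.continuousOn).congr
          fun c => (inv_eq c c.2).symm }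
  refine ⟨Φ, ⟨fun q hq => ⟨G, hG q hq, Eventually.of_forall fun _ => rfl⟩, ?_⟩, rfl, fun _ => rfl⟩
  exact hK.congr hV fun c hc => (inv_eq c hc).symm

theorem mem_deSitter_iff (q : Fin 4 → ℝ) :
    q ∈ deSitter ↔ (q 3 - q 0) * (q 3 + q 0) + q 1 ^ 2 + q 2 ^ 2 = 1 := by
  simp only [deSitter, lorentz, mem_ofPred_eq]
  constructor <;> intro h <;> linear_combination h

theorem deSitter_nonempty : deSitter.Nonempty := ⟨![0, 0, 1, 0], by simp [mem_deSitter_iff]⟩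

/-- The point of `ℝ⁴` with `x₃ + x₀ = ξ`, `x₁ = x`, `x₂ = y` and `x₃ - x₀ = s`. -/
def lightVec (ξ x y s : ℝ) : Fin 4 → ℝ := ![(ξ - s) / 2, x, y, (ξ + s) / 2]

theorem lightVec_mem {ξ x y s : ℝ} : lightVec ξ x y s ∈ deSitter ↔ s * ξ + x ^ 2 + y ^ 2 = 1 := by
  rw [mem_deSitter_iff]
  simp only [lightVec, Matrix.cons_val]
  constructor <;> intro h <;> linear_combination h

theorem lightVec_surj (q : Fin 4 → ℝ) : lightVec (q 3 + q 0) (q 1) (q 2) (q 3 - q 0) = q := by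
  ext i
  fin_cases i <;> simp [lightVec]

theorem lightVec_sub (ξ x y s : ℝ) : lightVec ξ x y s 3 - lightVec ξ x y s 0 = s := by
  simp only [lightVec, Matrix.cons_val]
  ring

theorem lightVec_add (ξ x y s : ℝ) : lightVec ξ x y s 3 + lightVec ξ x y s 0 = ξ := by
  simp only [lightVec, Matrix.cons_val]
  ring

theorem analyticAt_lightVec {E : Type*} [NormedAddCommGroup E] [NormedSpace ℝ E] {p : E}
    {ξ x y s : E → ℝ} (hξ : AnalyticAt ℝ ξ p) (hx : AnalyticAt ℝ x p) (hy : AnalyticAt ℝ y p)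
    (hs : AnalyticAt ℝ s p) : AnalyticAt ℝ (fun q => lightVec (ξ q) (x q) (y q) (s q)) p :=
  analyticAt_vec4 (by fun_prop) hx hy (by fun_prop)

/-- The extension of `extLE` to `ℝ³`. -/
def ambientLE (p : Fin 3 → ℝ) : Fin 4 → ℝ :=
  lightVec (p 0) (p 1) (yLE (p 2)) (Real.sinh (2 * p 2))

theorem extLE_coe (p : XLE) : (extLE p : Fin 4 → ℝ) = ambientLE p := rfl

theorem analyticOnNhd_ambientLE {s : Set (Fin 3 → ℝ)} : AnalyticOnNhd ℝ ambientLE s :=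
  fun _ _ => analyticAt_lightVec (by fun_prop) (by fun_prop) (by fun_prop) (by fun_prop)

/-- If coordinates `G` of de Sitter space satisfy `G ∘ ambientLE = straighten` on `XLE`, then
`extLE` becomes the inclusion of the cone. The global chart is cut down to the preimage of `U`,
because the image of its whole domain must lie in the domain of `G`. -/
theorem isDCRegularAt_extLE {G : (Fin 4 → ℝ) → Fin 3 → ℝ} {K : (Fin 3 → ℝ) → Fin 4 → ℝ}
    {U : Set (Fin 4 → ℝ)} {V : Set (Fin 3 → ℝ)} (hU : IsOpen U) (hV : IsOpen V)
    (hG : AnalyticOnNhd ℝ G U) (hK : AnalyticOnNhd ℝ K V)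
    (hGV : ∀ q ∈ deSitter, q ∈ U → G q ∈ V ∧ K (G q) = q)
    (hKU : ∀ c ∈ V, K c ∈ deSitter ∧ K c ∈ U ∧ G (K c) = c)
    (hGX : ∀ p ∈ XLE, ambientLE p ∈ U → G (ambientLE p) = straighten p)
    {p : XLE} (hp : ambientLE p ∈ U) : IsDCRegularAt 0 (inducedCharts XLE) extLE p := by
  obtain ⟨Φ, hΦ, hs, hΦG⟩ := exists_isAnalyticDiffeo deSitter_nonempty hU hV hG hK hGV hKU
  have hO : IsOpen (ambientLE ⁻¹' U) :=
    hU.preimage (analyticOnNhd_ambientLE (s := univ)).continuous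
  refine ⟨_, (isAmbientRestriction_chartLE.restrOpen hO).isDCCoordinate, ⟨mem_univ _, hp⟩,
    Φ, hΦ, fun q hq => ?_⟩
  have hq' : ambientLE q ∈ U := hq.2
  refine ⟨by rw [hs]; exact hq', ?_⟩
  rw [hΦG, Fin.append_right_nil _ _ rfl]
  exact hGX q q.2 hq'

/-- With s = sinh 2v one has cosh 2v = √(1 + s²) and v = arsinh(s)/2. -/
theorem graphFun_sinh (v : ℝ) : graphFun (Real.sinh (2 * v)) = yLE v := by
  rw [graphFun, yLE, Real.arsinh_sinh, add_comm 1, ← Real.cosh_sq,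
    Real.sqrt_sq (Real.cosh_pos _).le]
  ring

theorem graphFun_neg (s : ℝ) : graphFun (-s) = graphFun s := by
  simp [graphFun]

@[fun_prop]
theorem analyticAt_graphFun (s : ℝ) : AnalyticAt ℝ graphFun s := by
  have : AnalyticAt ℝ (fun s : ℝ => √(1 + s ^ 2)) s :=
    analyticAt_sqrt_comp (by fun_prop) (by positivity)
  unfold graphFun
  fun_prop

theorem isDCRegularAt_extLE_of_ne {p : XLE} (hp : p.1 2 ≠ 0) :
    IsDCRegularAt 0 (inducedCharts XLE) extLE p := by
  -- For q₃ ≠ q₀ the quadric equation gives q₃ + q₀, so q₁, q₂, q₃ − q₀ are coordinates. The image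
  -- is q₂ = g(q₃ − q₀), and there `b` equals −x²/a, which is ξ + k by the cone equation. The
  -- function `y` recovers q₂.
  let b : (Fin 4 → ℝ) → ℝ := fun q =>
    q 2 - graphFun (q 3 - q 0) - q 1 ^ 2 / (q 3 - q 0)
  let y : (Fin 3 → ℝ) → ℝ := fun c =>
    c 1 - c 2 + graphFun (c 1 + c 2) + c 0 ^ 2 / (c 1 + c 2)
  refine isDCRegularAt_extLE (U := {q | q 3 - q 0 ≠ 0}) (V := {c | c 1 + c 2 ≠ 0})
    (G := fun q => coneVec (q 1) (q 3 - q 0) (b q))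
    (K := fun c => lightVec ((1 - c 0 ^ 2 - y c ^ 2) / (c 1 + c 2)) (c 0) (y c) (c 1 + c 2))
    (isOpen_ne_fun (by fun_prop) (by fun_prop)) (isOpen_ne_fun (by fun_prop) (by fun_prop))
    ?_ ?_ ?_ ?_ ?_ ?_
  · intro q (hq : q 3 - q 0 ≠ 0)
    exact analyticAt_coneVec (by fun_prop) (by fun_prop) (by fun_prop (disch := assumption))
  · intro c (hc : c 1 + c 2 ≠ 0)
    have : AnalyticAt ℝ y c := by fun_prop (disch := assumption)
    exact analyticAt_lightVec (by fun_prop (disch := assumption)) (by fun_prop) this (by fun_prop)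
  · intro q hqN (hq : q 3 - q 0 ≠ 0)
    rw [mem_deSitter_iff] at hqN
    have h0 : ∀ x a b, coneVec x a b 0 = x := fun _ _ _ => rfl
    have hy : y (coneVec (q 1) (q 3 - q 0) (b q)) = q 2 := by
      simp only [y, b, coneVec_add, coneVec_sub, h0]
      ring
    refine ⟨by rwa [mem_ofPred_eq, coneVec_add], ?_⟩
    simp only [hy, coneVec_add, h0]
    convert lightVec_surj q using 2
    field_simp
    linear_combination -hqN
  · intro c (hc : c 1 + c 2 ≠ 0)
    have h1 : ∀ ξ x y s, lightVec ξ x y s 1 = x := fun _ _ _ _ => rfl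
    have h2 : ∀ ξ x y s, lightVec ξ x y s 2 = y := fun _ _ _ _ => rfl
    refine ⟨?_, by rwa [mem_ofPred_eq, lightVec_sub], ?_⟩
    · rw [lightVec_mem]
      field_simp
      ring
    · simp only [b, lightVec_sub, h1, h2]
      conv_rhs => rw [← coneVec_surj c]
      congr 1
      simp only [y]
      ring
  · intro p hp (hq : _ ≠ 0)
    have h1 : ambientLE p 1 = p 1 := rfl
    have h2 : ambientLE p 2 = yLE (p 2) := rfl
    have h3 : ambientLE p 3 - ambientLE p 0 = Real.sinh (2 * p 2) := lightVec_sub _ _ _ _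
    rw [h3] at hq
    rw [mem_XLE_iff, straighten, coneVec_mem] at hp
    simp only [b, h1, h2, h3, graphFun_sinh]
    rw [straighten]
    congr 1
    field_simp
    linear_combination -hp
  · rw [mem_ofPred_eq, ambientLE, lightVec_sub]
    simpa using hp

theorem isDCRegularAt_extLE_of_pos {p : XLE} (hp : 0 < yLE (p.1 2)) :
    IsDCRegularAt 0 (inducedCharts XLE) extLE p := by
  -- For q₂ > 0 the quadric is a graph over (q₁, q₃ − q₀, q₃ + q₀); `r` is the value of q₂², and `ξ`
  -- that of q₃ + q₀.
  let ξ : (Fin 3 → ℝ) → ℝ := fun c => c 1 - c 2 - kLE (Real.arsinh (c 1 + c 2) / 2)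
  let r : (Fin 3 → ℝ) → ℝ := fun c => 1 - c 0 ^ 2 - (c 1 + c 2) * ξ c
  refine isDCRegularAt_extLE (U := {q | 0 < q 2}) (V := {c | 0 < r c})
    (G := fun q => coneVec (q 1) (q 3 - q 0) (q 3 + q 0 + kLE (Real.arsinh (q 3 - q 0) / 2)))
    (K := fun c => lightVec (ξ c) (c 0) (√(r c)) (c 1 + c 2))
    (isOpen_lt (by fun_prop) (by fun_prop)) ?_
    ?_ ?_ ?_ ?_ ?_ hp
  · have hr : AnalyticOnNhd ℝ r univ := fun c _ => by fun_prop
    exact isOpen_lt continuous_const hr.continuous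
  · intro q _
    exact analyticAt_coneVec (by fun_prop) (by fun_prop) (by fun_prop)
  · intro c (hc : 0 < r c)
    exact analyticAt_lightVec (by fun_prop) (by fun_prop)
      (analyticAt_sqrt_comp (by fun_prop) hc) (by fun_prop)
  · intro q hqN (hq : 0 < q 2)
    rw [mem_deSitter_iff] at hqN
    have h0 : ∀ x a b, coneVec x a b 0 = x := fun _ _ _ => rfl
    have hr : r (coneVec (q 1) (q 3 - q 0) (q 3 + q 0 + kLE (Real.arsinh (q 3 - q 0) / 2))) =
        q 2 ^ 2 := by
      simp only [r, ξ, coneVec_add, coneVec_sub, h0]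
      linear_combination -hqN
    refine ⟨by rw [mem_ofPred_eq, hr]; positivity, ?_⟩
    simp only [hr, ξ, coneVec_add, coneVec_sub, h0, add_sub_cancel_right]
    rw [Real.sqrt_sq hq.le, lightVec_surj]
  · intro c (hc : 0 < r c)
    have h1 : ∀ ξ x y s, lightVec ξ x y s 1 = x := fun _ _ _ _ => rfl
    refine ⟨?_, Real.sqrt_pos.2 hc, ?_⟩
    · rw [lightVec_mem, Real.sq_sqrt hc.le]
      simp only [r]
      ring
    · simp only [lightVec_sub, lightVec_add, h1, ξ, sub_add_cancel]
      exact coneVec_surj c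
  · intro p hp _
    have h1 : ambientLE p 1 = p 1 := rfl
    have h2 : ambientLE p 3 + ambientLE p 0 = p 0 := lightVec_add _ _ _ _
    have h3 : ambientLE p 3 - ambientLE p 0 = Real.sinh (2 * p 2) := lightVec_sub _ _ _ _
    simp only [h1, h2, h3, Real.arsinh_sinh, straighten, mul_div_cancel_left₀ _
      (two_ne_zero' ℝ)]

theorem isDCImmersion_extLE : IsDCImmersion 0 (inducedCharts XLE) extLE where
  analytic := isDCAnalytic_of_ambient analyticOnNhd_ambientLE extLE_coe
  regular p := by
    by_cases h : p.1 2 = 0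
    · exact isDCRegularAt_extLE_of_pos (by simp [h, yLE])
    · exact isDCRegularAt_extLE_of_ne h

/-! ### The parametrization by `ℝ²` -/

/-- Off a = 0, the cone ab + x² = 0 is parametrized by x = −ua, b = −u²a, and ξ = b − k. -/
theorem mk_mem_XLE (u v : ℝ) :
    ![-kLE v - u ^ 2 * Real.sinh (2 * v), -(u * Real.sinh (2 * v)), v] ∈ XLE := by
  rw [mem_XLE_iff, straighten, coneVec_mem]
  simp only [Matrix.cons_val]
  ring

/-- The map `ℝ² → X_LE` through which `catenoidLE` factors. -/
def paramLE (w : Fin 2 → ℝ) : XLE :=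
  ⟨![-kLE (w 1) - w 0 ^ 2 * Real.sinh (2 * w 1), -(w 0 * Real.sinh (2 * w 1)), w 1],
    mk_mem_XLE _ _⟩

theorem analyticOnNhd_paramLE {s : Set (Fin 2 → ℝ)} :
    AnalyticOnNhd ℝ (fun w => (paramLE w : Fin 3 → ℝ)) s :=
  fun _ _ => analyticAt_vec3 (by fun_prop) (by fun_prop) (by fun_prop)

theorem continuous_paramLE : Continuous paramLE :=
  continuous_induced_rng.2 (analyticOnNhd_paramLE (s := univ)).continuous

/-- The explicit form of the G-catenoid in light-cone coordinates. -/
def catVec (u v : ℝ) : Fin 4 → ℝ :=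
  lightVec (-kLE v - u ^ 2 * Real.sinh (2 * v)) (-(u * Real.sinh (2 * v))) (yLE v)
    (Real.sinh (2 * v))

theorem extLE_paramLE_coe (w : Fin 2 → ℝ) :
    (extLE (paramLE w) : Fin 4 → ℝ) = catVec (w 0) (w 1) := rfl

theorem catenoidLE_eq : catenoidLE = extLE ∘ paramLE := by
  funext w
  apply Subtype.ext
  rw [Function.comp_apply, extLE_paramLE_coe]
  ext i
  fin_cases i <;>
    simp [catenoidLE, rotL, profileLE, catVec, lightVec, kLE] <;> ring

theorem analyticOnNhd_chart_paramLE {φ : OpenPartialHomeomorph XLE (doubleCone 2)}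
    (hφ : φ ∈ inducedCharts XLE) :
    AnalyticOnNhd ℝ (fun w => (φ (paramLE w) : Fin 3 → ℝ)) (paramLE ⁻¹' φ.source) := by
  obtain ⟨Φ, hΦ⟩ := exists_isAmbientRestriction hφ
  have : AnalyticOnNhd ℝ (Φ ∘ fun w => (paramLE w : Fin 3 → ℝ)) (paramLE ⁻¹' φ.source) :=
    hΦ.analytic.comp analyticOnNhd_paramLE fun w hw => by
      rw [hΦ.source_eq] at hw
      exact hw
  exact this.congr (φ.open_source.preimage continuous_paramLE) fun w hw => (hΦ.apply_eq _ hw).symm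

theorem eq_paramLE {p : XLE} (hp : p.1 2 ≠ 0) :
    paramLE ![-(p.1 1 / Real.sinh (2 * p.1 2)), p.1 2] = p := by
  have hs : Real.sinh (2 * p.1 2) ≠ 0 := by simpa using hp
  have h := (mem_XLE_iff p).1 p.2
  rw [straighten, coneVec_mem] at h
  apply Subtype.ext
  ext i
  fin_cases i
  · simp [paramLE]
    field_simp
    linear_combination -h
  · simp [paramLE, hs]
  · simp [paramLE]

/-- The coordinates `(u, v)` on the part `v ≠ 0` of `X_LE`. -/
def regularChartLE : OpenPartialHomeomorph XLE (Fin 2 → ℝ) where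
  toFun p := ![-(p.1 1 / Real.sinh (2 * p.1 2)), p.1 2]
  invFun := paramLE
  source := {p | p.1 2 ≠ 0}
  target := {w | w 1 ≠ 0}
  map_source' _ hp := hp
  map_target' _ hw := hw
  left_inv' _ hp := eq_paramLE hp
  right_inv' w hw := by
    have hs : Real.sinh (2 * w 1) ≠ 0 := by simpa using hw
    ext i
    fin_cases i
    · simp only [paramLE, Fin.zero_eta, Matrix.cons_val]
      field_simp
    · rfl
  open_source := by
    have : IsOpen {q : Fin 3 → ℝ | q 2 ≠ 0} := isOpen_ne_fun (by fun_prop) (by fun_prop)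
    exact this.preimage continuous_subtype_val
  open_target := isOpen_ne_fun (by fun_prop) (by fun_prop)
  continuousOn_toFun := by
    intro p (hp : p.1 2 ≠ 0)
    have hs : Real.sinh (2 * p.1 2) ≠ 0 := by simpa using hp
    have : AnalyticAt ℝ
        (fun q : Fin 3 → ℝ => ![-(q 1 / Real.sinh (2 * q 2)), q 2]) p :=
      analyticAt_vec2 (by fun_prop (disch := assumption)) (by fun_prop)
    exact (this.continuousAt.comp continuous_subtype_val.continuousAt).continuousWithinAt
  continuousOn_invFun := continuous_paramLE.continuousOn

theorem isRegularCoordinate_regularChartLE :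
    IsRegularCoordinate (inducedCharts XLE) regularChartLE where
  source_subset := by
    rw [dcPoints_XLE]
    intro p (hp : p.1 2 ≠ 0) (h : p.1 = 0)
    simp [h] at hp
  analytic_symm φ hφ := (analyticOnNhd_chart_paramLE hφ).mono inter_subset_right
  analytic φ hφ := by
    obtain ⟨Φ, hΦ⟩ := exists_isAmbientRestriction hφ
    refine hΦ.isRealAnalyticOnCone_comp_symm (O := {q | q 2 ≠ 0})
      (isOpen_ne_fun (by fun_prop) (by fun_prop))
      (G := fun q => ![-(q 1 / Real.sinh (2 * q 2)), q 2]) ?_ rfl fun _ _ => rfl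
    intro q (hq : q 2 ≠ 0)
    have hs : Real.sinh (2 * q 2) ≠ 0 := by simpa using hq
    exact analyticAt_vec2 (by fun_prop (disch := assumption)) (by fun_prop)

/-! ### Fundamental forms of the G-catenoid -/

theorem partialDeriv_eq {g : (Fin 2 → ℝ) → Fin 4 → ℝ} {w : Fin 2 → ℝ} {i : Fin 2}
    {g' : Fin 4 → ℝ} (hg : DifferentiableAt ℝ g w)
    (h : HasDerivAt (fun t => g (Function.update w i t)) g' (w i)) : partialDeriv i g w = g' := by
  have hd : HasFDerivAt g (fderiv ℝ g w) (Function.update w i (w i)) := by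
    rw [Function.update_eq_self]
    exact hg.hasFDerivAt
  exact (hd.comp_hasDerivAt (w i) (hasDerivAt_update w i (w i))).unique h

theorem hasDerivAt_lightVec {ξ x y s : ℝ → ℝ} {ξ' x' y' s' t : ℝ} (hξ : HasDerivAt ξ ξ' t)
    (hx : HasDerivAt x x' t) (hy : HasDerivAt y y' t) (hs : HasDerivAt s s' t) :
    HasDerivAt (fun t => lightVec (ξ t) (x t) (y t) (s t)) (lightVec ξ' x' y' s') t := by
  rw [hasDerivAt_pi]
  intro i
  fin_cases i
  · exact (hξ.sub hs).div_const 2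
  · exact hx
  · exact hy
  · exact (hξ.add hs).div_const 2

theorem lorentz_lightVec (ξ x y s ξ' x' y' s' : ℝ) :
    lorentz (lightVec ξ x y s) (lightVec ξ' x' y' s') =
      (ξ * s' + ξ' * s) / 2 + x * x' + y * y' := by
  simp only [lorentz, lightVec, Matrix.cons_val]
  ring

theorem hasDerivAt_sinh_two_mul (v : ℝ) :
    HasDerivAt (fun v => Real.sinh (2 * v)) (2 * Real.cosh (2 * v)) v := by
  have := ((hasDerivAt_id v).const_mul 2).sinh
  simpa [mul_comm] using this

theorem hasDerivAt_cosh_two_mul (v : ℝ) :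
    HasDerivAt (fun v => Real.cosh (2 * v)) (2 * Real.sinh (2 * v)) v := by
  have := ((hasDerivAt_id v).const_mul 2).cosh
  simpa [mul_comm] using this

theorem hasDerivAt_yLE (v : ℝ) :
    HasDerivAt yLE (Real.sinh (2 * v) - 2 * v * Real.cosh (2 * v)) v := by
  refine ((hasDerivAt_cosh_two_mul v).sub
    ((hasDerivAt_id v).mul (hasDerivAt_sinh_two_mul v))).congr_deriv ?_
  simp only [id]
  ring

theorem hasDerivAt_kLE (v : ℝ) :
    HasDerivAt kLE (2 * v ^ 2 * Real.cosh (2 * v) - 2 * v * Real.sinh (2 * v)) v := by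
  refine ((((hasDerivAt_id v).pow 2).const_add 1).mul (hasDerivAt_sinh_two_mul v)).sub
    (((hasDerivAt_id v).const_mul 2).mul (hasDerivAt_cosh_two_mul v)) |>.congr_deriv ?_
  simp only [id, Pi.pow_apply]
  push_cast
  ring

/-- `∂f/∂u` for the G-catenoid. -/
def catVecU (u v : ℝ) : Fin 4 → ℝ :=
  lightVec (-(2 * u * Real.sinh (2 * v))) (-Real.sinh (2 * v)) 0 0

/-- `∂f/∂v` for the G-catenoid. -/
def catVecV (u v : ℝ) : Fin 4 → ℝ :=
  lightVec (2 * v * Real.sinh (2 * v) - 2 * (u ^ 2 + v ^ 2) * Real.cosh (2 * v))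
    (-(2 * u * Real.cosh (2 * v))) (Real.sinh (2 * v) - 2 * v * Real.cosh (2 * v))
    (2 * Real.cosh (2 * v))

theorem partialDeriv_catVec_zero :
    partialDeriv 0 (fun w => catVec (w 0) (w 1)) = fun w => catVecU (w 0) (w 1) := by
  funext w
  refine partialDeriv_eq (AnalyticAt.differentiableAt (analyticAt_lightVec (by fun_prop)
    (by fun_prop) (by fun_prop) (by fun_prop))) ?_
  simp only [Function.update_self, ne_eq, one_ne_zero, not_false_eq_true,
    Function.update_of_ne]
  have h := hasDerivAt_id (w 0)
  refine (hasDerivAt_lightVec (((h.pow 2).mul_const _).const_sub _) (h.mul_const _).neg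
    (hasDerivAt_const _ _) (hasDerivAt_const _ _)).congr_deriv ?_
  simp [catVecU]

theorem partialDeriv_catVec_one :
    partialDeriv 1 (fun w => catVec (w 0) (w 1)) = fun w => catVecV (w 0) (w 1) := by
  funext w
  refine partialDeriv_eq (AnalyticAt.differentiableAt (analyticAt_lightVec (by fun_prop)
    (by fun_prop) (by fun_prop) (by fun_prop))) ?_
  simp only [Function.update_self, ne_eq, zero_ne_one, not_false_eq_true,
    Function.update_of_ne]
  have hs := hasDerivAt_sinh_two_mul (w 1)
  refine (hasDerivAt_lightVec ((hasDerivAt_kLE _).neg.sub (hs.const_mul _)) (hs.const_mul _).neg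
    (hasDerivAt_yLE _) hs).congr_deriv ?_
  rw [catVecV]
  congr 1 <;> ring

theorem partialDeriv_catVecU_zero (w : Fin 2 → ℝ) :
    partialDeriv 0 (fun w => catVecU (w 0) (w 1)) w =
      lightVec (-(2 * Real.sinh (2 * w 1))) 0 0 0 := by
  refine partialDeriv_eq (AnalyticAt.differentiableAt (analyticAt_lightVec (by fun_prop)
    (by fun_prop) (by fun_prop) (by fun_prop))) ?_
  simp only [Function.update_self, ne_eq, one_ne_zero, not_false_eq_true,
    Function.update_of_ne]
  have h := hasDerivAt_id (w 0)
  refine (hasDerivAt_lightVec ((h.const_mul 2).mul_const _).neg (hasDerivAt_const _ _)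
    (hasDerivAt_const _ _) (hasDerivAt_const _ _)).congr_deriv ?_
  simp

theorem partialDeriv_catVecV_one (w : Fin 2 → ℝ) :
    partialDeriv 1 (fun w => catVecV (w 0) (w 1)) w =
      lightVec ((2 - 4 * (w 0 ^ 2 + w 1 ^ 2)) * Real.sinh (2 * w 1))
        (-(4 * w 0 * Real.sinh (2 * w 1))) (-(4 * w 1 * Real.sinh (2 * w 1)))
        (4 * Real.sinh (2 * w 1)) := by
  refine partialDeriv_eq (AnalyticAt.differentiableAt (analyticAt_lightVec (by fun_prop)
    (by fun_prop) (by fun_prop) (by fun_prop))) ?_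
  simp only [Function.update_self, ne_eq, zero_ne_one, not_false_eq_true,
    Function.update_of_ne]
  have h := hasDerivAt_id (w 1)
  have hs := hasDerivAt_sinh_two_mul (w 1)
  have hc := hasDerivAt_cosh_two_mul (w 1)
  refine (hasDerivAt_lightVec
    (((h.const_mul 2).mul hs).sub ((((h.pow 2).const_add _).const_mul 2).mul hc))
    (hc.const_mul _).neg (hs.sub ((h.const_mul 2).mul hc)) (hc.const_mul 2)).congr_deriv ?_
  simp only [id, Nat.cast_ofNat, Pi.pow_apply]
  congr 1 <;> ring

/-- The parameters (u, v) are isothermal, so the mean curvature involves only the pure second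
derivatives. -/
theorem firstForm_catVec (w : Fin 2 → ℝ) :
    firstForm (fun w => catVec (w 0) (w 1)) w = Real.sinh (2 * w 1) ^ 2 • 1 := by
  ext i j
  fin_cases i <;> fin_cases j <;>
    simp [firstForm, partialDeriv_catVec_zero, partialDeriv_catVec_one, catVecU, catVecV,
      lorentz_lightVec] <;> ring

/-- The unit normal field of the G-catenoid with respect to which its mean curvature is one. -/
def catNormal (u v : ℝ) : Fin 4 → ℝ :=
  lightVec (2 * (u ^ 2 + v ^ 2) / Real.sinh (2 * v) + kLE v + u ^ 2 * Real.sinh (2 * v))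
    (2 * u / Real.sinh (2 * v) + u * Real.sinh (2 * v)) (2 * v / Real.sinh (2 * v) - yLE v)
    (-(2 / Real.sinh (2 * v)) - Real.sinh (2 * v))

theorem isUnitNormalAt_catNormal {w : Fin 2 → ℝ} (hw : w 1 ≠ 0) :
    IsUnitNormalAt (fun w => catVec (w 0) (w 1)) (fun w => catNormal (w 0) (w 1)) w := by
  have hs : Real.sinh (2 * w 1) ≠ 0 := by simpa using hw
  have h := Real.cosh_sq (2 * w 1)
  refine ⟨?_, ?_, fun i => ?_⟩
  · rw [catNormal, lorentz_lightVec, kLE, yLE]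
    field_simp
    linear_combination 2 * Real.sinh (2 * w 1) ^ 2 * h
  · rw [catNormal, catVec, lorentz_lightVec, kLE, yLE]
    field_simp
    linear_combination -2 * Real.sinh (2 * w 1) * h
  · fin_cases i
    · simp only [Fin.zero_eta, partialDeriv_catVec_zero]
      rw [catNormal, catVecU, lorentz_lightVec, kLE, yLE]
      field_simp
      ring
    · simp only [Fin.mk_one, partialDeriv_catVec_one]
      rw [catNormal, catVecV, lorentz_lightVec, kLE, yLE]
      field_simp
      ring

/-- With s = sinh 2v, the diagonal entries of the second form are s² + 2 and s² − 2; their sum 2s²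
is twice the conformal factor. -/
theorem meanCurvature_catVec {w : Fin 2 → ℝ} (hw : w 1 ≠ 0) :
    meanCurvature (fun w => catVec (w 0) (w 1)) (fun w => catNormal (w 0) (w 1)) w = 1 := by
  have hs : Real.sinh (2 * w 1) ≠ 0 := by simpa using hw
  have hinv : (Real.sinh (2 * w 1) ^ 2 • (1 : Matrix (Fin 2) (Fin 2) ℝ))⁻¹ =
      (Real.sinh (2 * w 1) ^ 2)⁻¹ • 1 := by
    refine Matrix.inv_eq_right_inv ?_
    rw [smul_mul_smul_comm, mul_one, mul_inv_cancel₀ (pow_ne_zero 2 hs), one_smul]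
  rw [meanCurvature, firstForm_catVec, hinv, smul_mul_assoc, one_mul, Matrix.trace_smul,
    Matrix.trace_fin_two, smul_eq_mul]
  simp only [secondForm, Matrix.of_apply, partialDeriv_catVec_zero, partialDeriv_catVec_one]
  rw [partialDeriv_catVecU_zero, partialDeriv_catVecV_one]
  simp only [catNormal, lorentz_lightVec, kLE, yLE]
  field_simp
  ring

theorem isSpacelikeCMC1_catVec :
    IsSpacelikeCMC1 {w | w 1 ≠ 0} (fun w => catVec (w 0) (w 1)) where
  analytic w _ := analyticAt_lightVec (by fun_prop) (by fun_prop) (by fun_prop) (by fun_prop)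
  mem_deSitter w _ := (extLE (paramLE w)).2
  spacelike w (hw : w 1 ≠ 0) := by
    have hs : Real.sinh (2 * w 1) ≠ 0 := by simpa using hw
    rw [firstForm_catVec]
    exact Matrix.PosDef.one.smul (by positivity)
  cmc1 := by
    refine ⟨fun w => catNormal (w 0) (w 1), ?_,
      fun w hw => ⟨isUnitNormalAt_catNormal hw, meanCurvature_catVec hw⟩⟩
    intro w (hw : w 1 ≠ 0)
    have hs : Real.sinh (2 * w 1) ≠ 0 := by simpa using hw
    exact (analyticAt_lightVec (by fun_prop (disch := assumption))
      (by fun_prop (disch := assumption)) (by fun_prop (disch := assumption))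
      (by fun_prop (disch := assumption))).continuousAt.continuousWithinAt

theorem isSpacelikeCMC1Near_of_ne {p : XLE} (hp : p.1 2 ≠ 0) :
    IsSpacelikeCMC1Near (inducedCharts XLE) extLE p :=
  ⟨regularChartLE, isRegularCoordinate_regularChartLE, hp, isSpacelikeCMC1_catVec⟩

/-! ### The light-like points -/

theorem ne_zero_of_isSpacelikeCMC1Near {p : XLE}
    (hp : IsSpacelikeCMC1Near (inducedCharts XLE) extLE p) : p.1 2 ≠ 0 := by
  intro hv
  obtain ⟨χ, hχ, hpχ, hg⟩ := hp
  set w := χ p with hw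
  have hwt : w ∈ χ.target := χ.map_source hpχ
  have hwp : χ.symm w = p := χ.left_inv hpχ
  -- On v = 0 the equation forces x = 0, so ξ = 0 would make `p` the origin, a DC-point.
  have hp0 : p.1 0 ≠ 0 := by
    intro h0
    have h1 := (mem_XLE_iff p).1 p.2
    rw [straighten, coneVec_mem, hv] at h1
    have hp : p ∈ dcPoints (inducedCharts XLE) := by
      rw [dcPoints_XLE]
      funext i
      fin_cases i
      · exact h0
      · simpa using h1
      · exact hv
    exact hχ.source_subset hpχ hp
  -- Analyticity of a regular coordinate is known only through charts; composing with
  -- `straightenSymm` transfers it to ℝ³.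
  let e : (Fin 2 → ℝ) → Fin 3 → ℝ := fun w => χ.symm w
  have he : DifferentiableAt ℝ e w := by
    have h1 : AnalyticAt ℝ (fun w => (chartLE (χ.symm w) : Fin 3 → ℝ)) w :=
      hχ.analytic_symm _ chartLE_mem w ⟨hwt, mem_univ _⟩
    have h2 := (analyticOnNhd_straightenSymm _ (mem_univ _)).comp h1
    refine h2.differentiableAt.congr_of_eventuallyEq (Eventually.of_forall fun z => ?_)
    exact (straightenHomeomorph.symm_apply_apply (e z)).symm
  have hpd : ∀ i, ∃ ξ' x' : ℝ, partialDeriv i (fun w => (extLE (χ.symm w) : Fin 4 → ℝ)) w =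
      lightVec ξ' x' 0 0 := by
    intro i
    have hd : HasFDerivAt e (fderiv ℝ e w) (Function.update w i (w i)) := by
      rw [Function.update_eq_self]
      exact he.hasFDerivAt
    have hc := hasDerivAt_pi.1 (hd.comp_hasDerivAt (w i) (hasDerivAt_update w i (w i)))
    set d := fderiv ℝ e w (Pi.single i 1) with hd'
    have hew : ∀ j, (e ∘ Function.update w i) (w i) j = p.1 j := by
      intro j
      rw [Function.comp_apply, Function.update_eq_self]
      exact congrFun (congrArg Subtype.val hwp) j
    have hs := (hasDerivAt_sinh_two_mul _).comp (w i) (hc 2)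
    have hk := (hasDerivAt_kLE _).comp (w i) (hc 2)
    have hy := (hasDerivAt_yLE _).comp (w i) (hc 2)
    have hx1 : p.1 1 = 0 := by
      have h1 := (mem_XLE_iff p).1 p.2
      rw [straighten, coneVec_mem, hv] at h1
      simpa using h1
    -- Differentiating sinh 2v (ξ + k) + x² = 0 at v = x = 0 leaves 2ξv′ = 0, hence v′ = 0.
    have hF := (hs.mul ((hc 0).add hk)).add ((hc 1).pow 2)
    have hz := hF.unique ((hasDerivAt_const (w i) (0 : ℝ)).congr_of_eventuallyEq
      (Eventually.of_forall fun t =>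
        coneVec_mem.1 ((mem_XLE_iff _).1 (χ.symm (Function.update w i t)).2)))
    simp only [Function.comp_apply, Function.update_eq_self] at hz hew
    simp [hew, hv, hx1, kLE, hp0] at hz
    refine ⟨d 0, d 1, partialDeriv_eq (hg.analytic w hwt).differentiableAt ?_⟩
    refine (hasDerivAt_lightVec (hc 0) (hc 1) hy hs).congr_deriv ?_
    rw [hz]
    simp
  obtain ⟨ξ₀, x₀, h0⟩ := hpd 0
  obtain ⟨ξ₁, x₁, h1⟩ := hpd 1
  -- On vectors `lightVec ξ' x' 0 0` the product only sees x′, so the first form has rank at most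
  -- one and zero determinant.
  have hdet := (hg.spacelike w hwt).det_pos
  rw [Matrix.det_fin_two] at hdet
  simp only [firstForm, Matrix.of_apply, h0, h1, lorentz_lightVec] at hdet
  ring_nf at hdet
  exact lt_irrefl _ hdet

theorem setOf_isSpacelikeCMC1Near_extLE :
    {p : XLE | IsSpacelikeCMC1Near (inducedCharts XLE) extLE p} =
      {p : XLE | (p : Fin 3 → ℝ) 2 ≠ 0} :=
  Set.ext fun _ => ⟨ne_zero_of_isSpacelikeCMC1Near, isSpacelikeCMC1Near_of_ne⟩

/-- Since a = sinh 2v, a curve in the cone with a ≠ 0 off t = 0 pulls back to points with v ≠ 0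
converging to `p`. -/
theorem mem_closure_of_cone_curve {p : XLE} {x a b : ℝ → ℝ} (hx : Continuous x)
    (ha : Continuous a) (hb : Continuous b) (h : ∀ t, a t * b t + x t ^ 2 = 0)
    (h0 : ∀ t ≠ 0, a t ≠ 0) (hp : straighten p = coneVec (x 0) (a 0) (b 0)) :
    p ∈ closure {p : XLE | (p : Fin 3 → ℝ) 2 ≠ 0} := by
  let γ : ℝ → XLE := fun t => chartLE.symm ⟨coneVec (x t) (a t) (b t), coneVec_mem.2 (h t)⟩
  have hγ : Continuous γ := by
    refine chartLE.symm.continuous.comp (continuous_induced_rng.2 (continuous_pi fun i => ?_))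
    fin_cases i
    · exact hx
    · exact (ha.add hb).div_const 2
    · exact (ha.sub hb).div_const 2
  have hγ0 : γ 0 = p := by
    rw [Homeomorph.symm_apply_eq]
    exact Subtype.ext hp.symm
  have ht : Tendsto γ (𝓝[≠] 0) (𝓝 p) := hγ0 ▸ hγ.continuousAt.tendsto.mono_left inf_le_left
  refine mem_closure_of_tendsto ht ?_
  filter_upwards [self_mem_nhdsWithin] with t h1
  have h2 : (γ t : Fin 3 → ℝ) = straightenSymm (coneVec (x t) (a t) (b t)) := rfl
  rw [h2, straightenSymm_coneVec]
  simpa using h0 t h1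

theorem dense_XLE : Dense {p : XLE | (p : Fin 3 → ℝ) 2 ≠ 0} := by
  intro p
  by_cases hv : p.1 2 = 0
  · have h := (mem_XLE_iff p).1 p.2
    rw [straighten, coneVec_mem] at h
    have hx : p.1 1 = 0 := by simpa [hv] using h
    by_cases hξ : p.1 0 = 0
    -- The vertex is approached along a line of the cone; the points with ξ ≠ 0, below, along the
    -- parabola b = ξ.
    · refine mem_closure_of_cone_curve (x := fun _ => 0) (a := fun t => t) (b := fun _ => 0)
        (by fun_prop) (by fun_prop) (by fun_prop) (by simp) (by simp) ?_
      simp [straighten, hx, hv, hξ, kLE]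
    · refine mem_closure_of_cone_curve (x := fun t => t * p.1 0) (a := fun t => -(t ^ 2 * p.1 0))
        (b := fun _ => p.1 0) (by fun_prop) (by fun_prop) (by fun_prop) (fun t => by ring)
        (by simp [hξ]) ?_
      simp [straighten, hx, hv, kLE]
  · exact subset_closure hv

theorem isSpacelikeCMC1DCImmersion_extLE :
    IsSpacelikeCMC1DCImmersion (inducedCharts XLE) extLE where
  connected := chartLE.symm.surjective.connectedSpace chartLE.symm.continuous
  isDCManifold := isDCManifold_XLE
  isDCImmersion := isDCImmersion_extLE
  cmc1 := ⟨_, regularChartLE.open_source, dense_XLE,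
    isRegularCoordinate_regularChartLE.source_subset, fun _ => isSpacelikeCMC1Near_of_ne⟩

/-! ### The image of the extension -/

theorem range_extLE : range extLE = range catenoidLE ∪ lightLine := by
  ext q
  constructor
  · rintro ⟨p, rfl⟩
    by_cases hv : p.1 2 = 0
    · right
      have h := (mem_XLE_iff p).1 p.2
      rw [straighten, coneVec_mem] at h
      have hx : p.1 1 = 0 := by simpa [hv] using h
      refine ⟨p.1 0 / 2, ?_⟩
      simp [extLE, hv, hx, yLE]
    · left
      exact ⟨_, by rw [catenoidLE_eq, Function.comp_apply, eq_paramLE hv]⟩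
  · rintro (⟨w, rfl⟩ | ⟨t, ht⟩)
    · exact ⟨paramLE w, by rw [catenoidLE_eq]; rfl⟩
    · refine ⟨⟨![2 * t, 0, 0], by simp [XLE, yLE]⟩, Subtype.ext ?_⟩
      rw [ht]
      simp [extLE, yLE]

theorem isAnalyticExtension_extLE : IsAnalyticExtension (inducedCharts XLE) catenoidLE extLE := by
  refine ⟨⟨paramLE, continuous_paramLE, fun ψ hψ => analyticOnNhd_chart_paramLE hψ,
    catenoidLE_eq⟩, ?_⟩
  -- On v = 0 the G-catenoid collapses to (0, 0, 1, 0) for every u, so any other point of the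
  -- light-like line is missed.
  have hl : (![1, 0, 1, 1] : Fin 4 → ℝ) ∈ deSitter := by simp [mem_deSitter_iff]
  refine (ssubset_iff_of_subset (range_extLE ▸ subset_union_left)).2 ⟨⟨_, hl⟩, ?_, ?_⟩
  · rw [range_extLE]
    exact Or.inr ⟨1, rfl⟩
  · rintro ⟨w, hw⟩
    rw [catenoidLE_eq] at hw
    have h : catVec (w 0) (w 1) = ![1, 0, 1, 1] := congrArg Subtype.val hw
    have hs : Real.sinh (2 * w 1) = 0 := by
      have := lightVec_sub (-kLE (w 1) - w 0 ^ 2 * Real.sinh (2 * w 1))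
        (-(w 0 * Real.sinh (2 * w 1))) (yLE (w 1)) (Real.sinh (2 * w 1))
      rw [← catVec, h] at this
      simpa using this.symm
    have hv : w 1 = 0 := by simpa using hs
    have h3 := congrFun h 3
    simp [catVec, lightVec, hv, kLE] at h3

theorem range_extLE_eq_graph : range extLE =
    {q : deSitter | (q : Fin 4 → ℝ) 2 = graphFun ((q : Fin 4 → ℝ) 0 - (q : Fin 4 → ℝ) 3)} := by
  ext q
  rw [mem_ofPred_eq, ← neg_sub, graphFun_neg]
  constructor
  · rintro ⟨p, rfl⟩
    rw [extLE_coe, ambientLE, lightVec_sub, graphFun_sinh]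
    rfl
  · intro h
    have hs : Real.sinh (2 * (Real.arsinh (q.1 3 - q.1 0) / 2)) = q.1 3 - q.1 0 := by
      rw [mul_div_cancel₀ _ (two_ne_zero' ℝ), Real.sinh_arsinh]
    have hy : yLE (Real.arsinh (q.1 3 - q.1 0) / 2) = q.1 2 := by rw [h, ← hs, graphFun_sinh, hs]
    refine ⟨⟨![q.1 3 + q.1 0, q.1 1, Real.arsinh (q.1 3 - q.1 0) / 2], ?_⟩, Subtype.ext ?_⟩
    · have := (mem_deSitter_iff _).1 q.2
      simp only [XLE, mem_ofPred_eq, Matrix.cons_val, hs, hy]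
      linear_combination this
    · rw [extLE_coe, ambientLE]
      simp only [Matrix.cons_val, hs, hy]
      exact lightVec_surj _

/-- The trace on `N` of the zero set of a real analytic function on `ℝ^k` is globally analytic. -/
theorem isGloballyAnalytic_of_ambient {k : ℕ} {N : Set (Fin k → ℝ)} {h : (Fin k → ℝ) → ℝ}
    (hh : AnalyticOnNhd ℝ h univ) : IsGloballyAnalytic {q : N | h q = 0} := by
  refine ⟨1, one_pos, fun q _ => h q, fun p =>
    ⟨fun q _ => h q, ?_, Eventually.of_forall fun _ => rfl⟩, ?_⟩
  · rw [analyticAt_pi_iff]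
    exact fun _ => hh p (mem_univ _)
  · ext q
    simp [funext_iff]

/-- The trace on `N` of the zero set of a real analytic function on `ℝ^k` is analytically
complete. -/
theorem isAnalyticallyComplete_of_ambient {k : ℕ} {N : Set (Fin k → ℝ)} {h : (Fin k → ℝ) → ℝ}
    (hh : AnalyticOnNhd ℝ h univ) (hne : {q : N | h q = 0}.Nonempty) :
    IsAnalyticallyComplete {q : N | h q = 0} := by
  refine ⟨hne, fun Γ hΓ hN ε hε hεS => ?_⟩
  have hz : ∀ t ∈ Ico (0 : ℝ) ε, h (Γ t) = 0 := by
    intro t ht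
    obtain ⟨q, hq, hqt⟩ := hεS t ht
    rw [← hqt]
    exact hq
  have ha : AnalyticOnNhd ℝ (h ∘ Γ) (Icc 0 1) := hh.comp hΓ (mapsTo_univ _ _)
  -- The identity theorem needs vanishing on a full neighbourhood in ℝ, which [0, ε) provides at ε/2
  -- but not at 0.
  have hmem : ε / 2 ∈ Icc (0 : ℝ) 1 := ⟨by linarith [hε.1], by linarith [hε.1, hε.2]⟩
  have hev : h ∘ Γ =ᶠ[𝓝 (ε / 2)] 0 := by
    filter_upwards [Ioo_mem_nhds (half_pos hε.1) (half_lt_self hε.1)] with t ht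
    exact hz t ⟨ht.1.le, ht.2⟩
  intro t ht
  exact ⟨⟨Γ t, hN t ht⟩, ha.eqOn_zero_of_preconnected_of_eventuallyEq_zero isPreconnected_Icc
    hmem hev ht, rfl⟩

end DCGeometry

end

open DCGeometry in
theorem mainTheorem12 :
    IsDCManifold (inducedCharts XLE) ∧
    dcPoints (inducedCharts XLE) = {p : XLE | (p : Fin 3 → ℝ) = 0} ∧
    IsSpacelikeCMC1DCImmersion (inducedCharts XLE) extLE ∧
    {p : XLE | IsSpacelikeCMC1Near (inducedCharts XLE) extLE p} =
      {p : XLE | (p : Fin 3 → ℝ) 2 ≠ 0} ∧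
    IsAnalyticExtension (inducedCharts XLE) catenoidLE extLE ∧
    Set.range extLE = Set.range catenoidLE ∪ lightLine ∧
    AnalyticOnNhd ℝ graphFun Set.univ ∧
    Set.range extLE =
      {q : deSitter | (q : Fin 4 → ℝ) 2 =
        graphFun ((q : Fin 4 → ℝ) 0 - (q : Fin 4 → ℝ) 3)} ∧
    IsGloballyAnalytic (Set.range extLE) ∧
    IsAnalyticallyComplete (Set.range extLE) := by
  have hg : AnalyticOnNhd ℝ
      (fun q : Fin 4 → ℝ => q 2 - graphFun (q 0 - q 3)) Set.univ := fun q _ => by fun_prop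
  -- The graph equation becomes the vanishing of a function analytic on all of ℝ⁴, as both closing
  -- lemmas require.
  have hr : Set.range extLE =
      {q : deSitter | (q : Fin 4 → ℝ) 2 -
        graphFun ((q : Fin 4 → ℝ) 0 - (q : Fin 4 → ℝ) 3) = 0} := by
    simp only [range_extLE_eq_graph, sub_eq_zero]
  have hne : (Set.range extLE).Nonempty := Set.range_nonempty_iff_nonempty.2 ⟨paramLE 0⟩
  refine ⟨isDCManifold_XLE, dcPoints_XLE, isSpacelikeCMC1DCImmersion_extLE,
    setOf_isSpacelikeCMC1Near_extLE, isAnalyticExtension_extLE, range_extLE,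
    fun s _ => analyticAt_graphFun s, range_extLE_eq_graph, ?_, ?_⟩
  · rw [hr]
    exact isGloballyAnalytic_of_ambient hg
  · rw [hr] at hne ⊢
    exact isAnalyticallyComplete_of_ambient hg hne
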